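/- Let $N,\lambda$ be positive integers, let $\rho$ be an $N\times N$ density matrix (the initial state of the system), $\varrho$ a $\lambda\times\lambda$ density matrix (the initial state of the environment), and $\theta$ an $N\times N$ Hermitian matrix (the observable). Let $\mathcal U(\lambda N)$ be the group of unitary matrices on $\mathbb C^N\otimes\mathbb C^\lambda$, put $\mathscr F_\varrho(U)=U(I_N\otimes\varrho^{1/2})$, and let $\mathbb K[\varrho,N]=\mathscr F_\varrho(\mathcal U(\lambda N))$ be the set of Kraus representations generated from $\varrho$; the open system is fully controllable in the sense that every element of $\mathbb K[\varrho,N]$ is available. For $K\in\mathbb K[\varrho,N]$ let $K_{\alpha\beta}$ $(1\le\alpha,\beta\le\lambda)$ be its $N\times N$ blocks, so that the $(i,j)$ entry of $K_{\alpha\beta}$ is the $((i,\alpha),(j,\beta))$ entry of $K$. Consider the open-system landscape $$J(K)=\operatorname{Tr}\Big(\sum_{\alpha,\beta=1}^{\lambda}K_{\alpha\beta}\,\rho\,K_{\alpha\beta}^\dagger\,\theta\Big),\qquad K\in\mathbb K[\varrho,N],$$ and the lifted landscape $$\widehat J(U)=\operatorname{Tr}\big(UPU^\dagger\Theta\big),\qquad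 P=\rho\otimes\varrho,\quad \Theta=\theta\otimes I_\lambda,\qquad U\in\mathcal U(\lambda N).$$ Both sets are regarded as embedded submanifolds of the space of complex $\lambda N\times\lambda N$ matrices. Then: 1. $J$ and $\widehat J$ are real valued, $J(K)=\operatorname{Tr}\{K(\rho\otimes I_\lambda)K^\dagger(\theta\otimes I_\lambda)\}$ for all $K\in\mathbb K[\varrho,N]$, and $J(\mathscr F_\varrho(U))=\widehat J(U)$ for all $U\in\mathcal U(\lambda N)$. 2. $J$ has the same critical structure as $\widehat J$. For every $U\in\mathcal U(\lambda N)$, $U$ is a critical point (respectively a local maximum, a local minimum) of $\widehat J$ on $\mathcal U(\lambda N)$ if and only if $\mathscr F_\varrho(U)$ is a critical point (respectively a local maximum, a local minimum) of $J$ on $\mathbb K[\varrho,N]$. If $U$ is critical, then the Hessian quadratic form of $\widehat J$ on the tangent space at $U$ and that of $J$ on the tangent space at $\mathscr F_\varrho(U)$ exist and are unique, and they have the same number of positive eigenvalues and the same number of negative eigenvalues. Moreover $C\mapsto\mathscr F_\varrho(C)$ is a bijection from the set of connected components of the critical set of $\widehat J$ onto the set of connected components of the critical set of $J$. 3. $J$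 has no false traps: every local maximum of $J$ on $\mathbb K[\varrho,N]$ is a global maximum, and every local minimum of $J$ on $\mathbb K[\varrho,N]$ is a global minimum. -/

import Mathlib

open Matrix
open scoped Kronecker ContDiff ComplexOrder MatrixOrder Matrix.Norms.Elementwise

noncomputable section

namespace OpenLandscape

/-! ### Critical points and Hessians on embedded submanifolds of a normed space

The two search spaces below are compact embedded submanifolds of a space of matrices. Tangent
vectors, critical points and Hessians on such a submanifold are described by smooth curves in it. -/

section Submanifold

variable {E : Type*} [NormedAddCommGroup E] [NormedSpace ℝ E]

/-- `γ` is a smooth curve in `M` that passes through `x` at time `0`. -/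
def IsCurveThrough (M : Set E) (x : E) (γ : ℝ → E) : Prop :=
  ContDiff ℝ ∞ γ ∧ (∀ t, γ t ∈ M) ∧ γ 0 = x

/-- The tangent space of `M` at `x`: the (span of the) velocities of smooth curves in `M`
through `x`. -/
def tangentSpace (M : Set E) (x : E) : Submodule ℝ E :=
  Submodule.span ℝ {v | ∃ γ, IsCurveThrough M x γ ∧ deriv γ 0 = v}

/-- The velocity of a curve in `M` through `x`, as a tangent vector. -/
def velocity {M : Set E} {x : E} {γ : ℝ → E} (h : IsCurveThrough M x γ) : tangentSpace M x :=
  ⟨deriv γ 0, Submodule.subset_span ⟨γ, h, rfl⟩⟩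

/-- `x ∈ M` is a critical point of `f` on `M`: the derivative of `f` vanishes along every smooth
curve in `M` through `x`. -/
def IsCriticalOn (f : E → ℝ) (M : Set E) (x : E) : Prop :=
  x ∈ M ∧ ∀ γ, IsCurveThrough M x γ → deriv (f ∘ γ) 0 = 0

/-- The set of critical points of `f` on `M`. -/
def criticalSet (f : E → ℝ) (M : Set E) : Set E :=
  {x | IsCriticalOn f M x}

/-- `Q` is the Hessian quadratic form of `f` on `M` at (the critical point) `x`: the second
derivative of `f` along a curve in `M` through `x` is the value of `Q` at the velocity. -/
def IsHessianOn (f : E → ℝ) (M : Set E) (x : E) (Q : QuadraticForm ℝ (tangentSpace M x)) : Prop :=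
  ∀ (γ : ℝ → E) (h : IsCurveThrough M x γ), iteratedDeriv 2 (f ∘ γ) 0 = Q (velocity h)

end Submanifold

/-- The set of connected components of the subspace `S`. -/
def components {X : Type*} [TopologicalSpace X] (S : Set X) : Set (Set X) :=
  {C | ∃ x ∈ S, C = connectedComponentIn S x}

/-! ### Kraus representations and the two landscapes

The composite space `ℂ^N ⊗ ℂ^lam` has the index set `Fin N × Fin lam`. -/

/-- Density matrices. -/
def IsDensityMatrix {n : ℕ} (A : Matrix (Fin n) (Fin n) ℂ) : Prop :=
  A.PosSemidef ∧ A.trace = 1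

/-- The set of unitary matrices on the composite space. -/
def unitarySet (N lam : ℕ) : Set (Matrix (Fin N × Fin lam) (Fin N × Fin lam) ℂ) :=
  {U | U ∈ Matrix.unitaryGroup (Fin N × Fin lam) ℂ}

/-- The map `U ↦ U (I_N ⊗ ϱ^{1/2})`. -/
def krausMap (N : ℕ) {lam : ℕ} (ϱ : Matrix (Fin lam) (Fin lam) ℂ)
    (U : Matrix (Fin N × Fin lam) (Fin N × Fin lam) ℂ) :
    Matrix (Fin N × Fin lam) (Fin N × Fin lam) ℂ :=
  U * ((1 : Matrix (Fin N) (Fin N) ℂ) ⊗ₖ CFC.sqrt ϱ)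

/-- The set `𝕂[ϱ, N]` of Kraus representations: the image of the unitary group. -/
def krausSet (N : ℕ) {lam : ℕ} (ϱ : Matrix (Fin lam) (Fin lam) ℂ) :
    Set (Matrix (Fin N × Fin lam) (Fin N × Fin lam) ℂ) :=
  krausMap N ϱ '' unitarySet N lam

/-- The Kraus operator `K_{αβ}`, the `(α, β)`-th `N × N` block of `K`. -/
def krausOp {N lam : ℕ} (K : Matrix (Fin N × Fin lam) (Fin N × Fin lam) ℂ) (α β : Fin lam) :
    Matrix (Fin N) (Fin N) ℂ :=
  Matrix.of fun i j => K (i, α) (j, β)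

/-- `Tr (∑_{α,β} K_{αβ} ρ K_{αβ}† θ)`. -/
def krausTrace {N lam : ℕ} (ρ θ : Matrix (Fin N) (Fin N) ℂ)
    (K : Matrix (Fin N × Fin lam) (Fin N × Fin lam) ℂ) : ℂ :=
  Matrix.trace ((∑ α, ∑ β, krausOp K α β * ρ * (krausOp K α β)ᴴ) * θ)

/-- The open-system landscape `J(K)`. -/
def openLandscape {N lam : ℕ} (ρ θ : Matrix (Fin N) (Fin N) ℂ)
    (K : Matrix (Fin N × Fin lam) (Fin N × Fin lam) ℂ) : ℝ :=
  (krausTrace ρ θ K).re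

/-- `Tr (U P U† Θ)` with `P = ρ ⊗ ϱ` and `Θ = θ ⊗ I`. -/
def liftedTrace {N lam : ℕ} (ρ θ : Matrix (Fin N) (Fin N) ℂ) (ϱ : Matrix (Fin lam) (Fin lam) ℂ)
    (U : Matrix (Fin N × Fin lam) (Fin N × Fin lam) ℂ) : ℂ :=
  Matrix.trace (U * (ρ ⊗ₖ ϱ) * Uᴴ * (θ ⊗ₖ (1 : Matrix (Fin lam) (Fin lam) ℂ)))

/-- The lifted landscape. -/
def liftedLandscape {N lam : ℕ} (ρ θ : Matrix (Fin N) (Fin N) ℂ)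
    (ϱ : Matrix (Fin lam) (Fin lam) ℂ)
    (U : Matrix (Fin N × Fin lam) (Fin N × Fin lam) ℂ) : ℝ :=
  (liftedTrace ρ θ ϱ U).re

end OpenLandscape

end

open OpenLandscape

/-!
Both landscapes are instances of `X ↦ Re Tr (X P X† Θ)` (`traceForm`): the lifted one on the unitary
group, with `P = ρ ⊗ ϱ`, and the open-system one on the orbit of `A = I ⊗ ϱ^{1/2}` under left
multiplication by unitaries, with `ρ ⊗ I` in place of `P`. Since `A (ρ ⊗ I) A = ρ ⊗ ϱ`, the map
`U ↦ U A` intertwines them.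

The map `U ↦ U A` is a submersion of the unitary group onto the orbit, in the concrete sense that it
has smooth local sections (`exists_local_section`), rational in the entries of the matrices and of
their conjugates: with `p` the projection onto
the range of `A`, a point `X = V A` of the orbit determines the partial isometry `V p`, and `p` is
carried to a nearby partial isometry `Z` with initial projection `p` by the Cayley transform of a
skew-Hermitian solution `S` of `S (Z + p) = Z - p`. Hence curves in the orbit lift to curves in
the unitary group, local extrema and critical points correspond, and the Hessian of the lifted
landscape is the pullback of the Hessian on the orbit along a surjective linear map, which preserves
the numbers of positive and of negative eigenvalues (`signature_eq`). The Hessian on the unitary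
group exists because a curve through `U` with velocity `v` has acceleration `-v v† U` up to a
tangent vector, on which the first derivative vanishes at a critical point.

The fibres of `U ↦ U A` are cosets of the stabilizer of `A`, which is connected
(`isConnected_stabilizer`): a phase on the kernel of `A` moves any element of it away from the
eigenvalue `-1`, and a Cayley path then leads to `1`. The critical set upstairs is compact and
saturated, so it maps to the critical set downstairs by a quotient map with connected fibres, and
such a map induces a bijection of connected components (`bijOn_components`).

There are no traps on the unitary group (`isMaxOn_of_isLocalMaxOn`): at a local maximum `U`, the
first-order condition says that `U P U†` commutes with `Θ`, so the two are simultaneously diagonal;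
the second-order condition along rotations in coordinate planes says that their eigenvalues are
similarly ordered; and then the rearrangement inequality, together with Birkhoff's theorem for the
doubly stochastic matrix `|X i j|²`, shows that the value is the global maximum. The correspondence
of local extrema transports this to the orbit, and `Θ ↦ -Θ` handles the minima.
-/

namespace OpenLandscape

open Filter Topology

set_option linter.unusedSectionVars false

section General

variable {n : Type*} [Fintype n] [DecidableEq n]

/-! ### Smoothness of the matrix operations -/

section Calculus

theorem contDiffAt_matrix_iff {F : Type*} [NormedAddCommGroup F] [NormedSpace ℝ F]
    {k : WithTop ℕ∞} {f : F → Matrix n n ℂ} {x : F} :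
    ContDiffAt ℝ k f x ↔ ∀ i j, ContDiffAt ℝ k (fun y => f y i j) x := by
  refine ⟨fun h i j => ?_, fun h => ?_⟩
  · exact contDiffAt_pi.1 (contDiffAt_pi.1 h i) j
  · exact contDiffAt_pi.2 fun i => contDiffAt_pi.2 fun j => h i j

/-- Matrix multiplication as a continuous bilinear map. -/
noncomputable def mulBilin (n : Type*) [Fintype n] [DecidableEq n] :
    Matrix n n ℂ →L[ℝ] Matrix n n ℂ →L[ℝ] Matrix n n ℂ :=
  (LinearMap.mul ℝ (Matrix n n ℂ)).toContinuousBilinearMap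

/-- The conjugate transpose as a continuous real linear map. -/
noncomputable def conjTransposeCLM (n : Type*) [Fintype n] [DecidableEq n] :
    Matrix n n ℂ →L[ℝ] Matrix n n ℂ :=
  (conjTransposeLinearEquiv n n ℝ ℂ).toLinearMap.toContinuousLinearMap

theorem _root_.ContDiffAt.matrix_mul {F : Type*} [NormedAddCommGroup F] [NormedSpace ℝ F]
    {k : WithTop ℕ∞} {f g : F → Matrix n n ℂ} {x : F}
    (hf : ContDiffAt ℝ k f x) (hg : ContDiffAt ℝ k g x) :
    ContDiffAt ℝ k (fun y => f y * g y) x :=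
  ((mulBilin n).isBoundedBilinearMap.contDiff.contDiffAt).comp x (hf.prodMk hg)

theorem _root_.ContDiffAt.matrix_conjTranspose {F : Type*} [NormedAddCommGroup F]
    [NormedSpace ℝ F] {k : WithTop ℕ∞} {f : F → Matrix n n ℂ} {x : F}
    (hf : ContDiffAt ℝ k f x) : ContDiffAt ℝ k (fun y => (f y)ᴴ) x :=
  (conjTransposeCLM n).contDiff.contDiffAt.comp x hf

theorem _root_.ContDiffAt.matrix_det {F : Type*} [NormedAddCommGroup F] [NormedSpace ℝ F]
    {k : WithTop ℕ∞} {f : F → Matrix n n ℂ} {x : F} (hf : ContDiffAt ℝ k f x) :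
    ContDiffAt ℝ k (fun y => (f y).det) x := by
  simp only [det_apply]
  refine ContDiffAt.sum fun σ _ => ContDiffAt.const_smul _ (contDiffAt_prod fun i _ => ?_)
  exact contDiffAt_matrix_iff.1 hf _ _

theorem _root_.ContDiffAt.matrix_inv {F : Type*} [NormedAddCommGroup F] [NormedSpace ℝ F]
    {k : WithTop ℕ∞} {f : F → Matrix n n ℂ} {x : F} (hf : ContDiffAt ℝ k f x)
    (hx : IsUnit (f x)) : ContDiffAt ℝ k (fun y => (f y)⁻¹) x := by
  have hdet : (f x).det ≠ 0 := ((isUnit_iff_isUnit_det _).1 hx).ne_zero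
  simp only [inv_def, Ring.inverse_eq_inv']
  refine (hf.matrix_det.inv hdet).smul (contDiffAt_matrix_iff.2 fun i j => ?_)
  simp only [adjugate_apply]
  refine ContDiffAt.matrix_det (contDiffAt_matrix_iff.2 fun a b => ?_)
  by_cases h : a = j
  · subst h
    simpa using contDiffAt_const
  · simpa [updateRow_ne h] using contDiffAt_matrix_iff.1 hf a b

theorem hasDerivAt_deriv_of_contDiffAt {F : Type*} [NormedAddCommGroup F] [NormedSpace ℝ F]
    {γ : ℝ → F} {t : ℝ} (h : ContDiffAt ℝ ∞ γ t) :
    HasDerivAt (deriv γ) (deriv (deriv γ) t) t := by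
  have h2 : ContDiffAt ℝ 1 (fderiv ℝ γ) t := h.fderiv_right (by norm_cast)
  have h3 : ContDiffAt ℝ 1 (deriv γ) t := by
    simpa only [fderiv_apply_one_eq_deriv] using h2.clm_apply (contDiffAt_const (c := (1 : ℝ)))
  exact (h3.differentiableAt (by simp)).hasDerivAt

theorem _root_.HasDerivAt.matrix_mul {f g : ℝ → Matrix n n ℂ} {f' g' : Matrix n n ℂ} {t : ℝ}
    (hf : HasDerivAt f f' t) (hg : HasDerivAt g g' t) :
    HasDerivAt (fun y => f y * g y) (f t * g' + f' * g t) t :=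
  
  (mulBilin n).hasDerivAt_of_bilinear (fun _ => hf) (fun _ => hg)

theorem _root_.HasDerivAt.matrix_conjTranspose {f : ℝ → Matrix n n ℂ} {f' : Matrix n n ℂ}
    {t : ℝ} (hf : HasDerivAt f f' t) : HasDerivAt (fun y => (f y)ᴴ) f'ᴴ t :=
  (conjTransposeCLM n).hasFDerivAt.comp_hasDerivAt t hf

/-- The real part of the trace, as a real linear functional. -/
noncomputable def reTrace (n : Type*) [Fintype n] [DecidableEq n] : Matrix n n ℂ →ₗ[ℝ] ℝ :=
  Complex.reLm ∘ₗ (traceLinearMap n ℝ ℂ)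

theorem continuous_reTrace : Continuous (reTrace n) :=
  LinearMap.continuous_of_finiteDimensional _

theorem _root_.HasDerivAt.reTrace {f : ℝ → Matrix n n ℂ} {f' : Matrix n n ℂ} {t : ℝ}
    (hf : HasDerivAt f f' t) :
    HasDerivAt (fun y => OpenLandscape.reTrace n (f y)) (OpenLandscape.reTrace n f') t :=
  (LinearMap.toContinuousLinearMap (OpenLandscape.reTrace n)).hasFDerivAt.comp_hasDerivAt t hf

theorem reTrace_apply (X : Matrix n n ℂ) : reTrace n X = X.trace.re := rfl

theorem reTrace_mul_comm (X Y : Matrix n n ℂ) : reTrace n (X * Y) = reTrace n (Y * X) := by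
  rw [reTrace_apply, trace_mul_comm, reTrace_apply]

theorem reTrace_conjTranspose (X : Matrix n n ℂ) : reTrace n Xᴴ = reTrace n X := by
  simp [reTrace_apply, trace_conjTranspose]

end Calculus

/-! ### The Cayley transform -/

section Cayley

/-- The Cayley transform `(1 - S)⁻¹ (1 + S)`; it maps skew-Hermitian matrices to unitary ones. -/
noncomputable def cayley (S : Matrix n n ℂ) : Matrix n n ℂ := (1 - S)⁻¹ * (1 + S)

theorem isUnit_one_sub_of_skew {S : Matrix n n ℂ} (hS : Sᴴ = -S) : IsUnit (1 - S) := by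
  have h : ((1 - S)ᴴ * (1 - S)) = 1 + Sᴴ * S := by
    simp only [conjTranspose_sub, conjTranspose_one, hS]; noncomm_ring
  have hp : (1 + Sᴴ * S).PosDef :=
    PosDef.one.add_posSemidef (posSemidef_conjTranspose_mul_self S)
  have hu := hp.isUnit
  rw [← h, isUnit_iff_isUnit_det, det_mul] at hu
  exact (isUnit_iff_isUnit_det _).2 (isUnit_of_mul_isUnit_right hu)

theorem cayley_zero : cayley (0 : Matrix n n ℂ) = 1 := by simp [cayley]

theorem one_sub_mul_cayley {S : Matrix n n ℂ} (hS : Sᴴ = -S) :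
    (1 - S) * cayley S = 1 + S := by
  rw [cayley, mul_nonsing_inv_cancel_left]
  exact (isUnit_iff_isUnit_det _).1 (isUnit_one_sub_of_skew hS)

theorem cayley_mem_unitaryGroup {S : Matrix n n ℂ} (hS : Sᴴ = -S) :
    cayley S ∈ unitaryGroup n ℂ := by
  have h1 := (isUnit_iff_isUnit_det _).1 (isUnit_one_sub_of_skew hS)
  have h2 : IsUnit (1 + S).det := by
    have := isUnit_one_sub_of_skew (S := -S) (by simp [hS])
    rw [sub_neg_eq_add] at this
    exact (isUnit_iff_isUnit_det _).1 this
  rw [mem_unitaryGroup_iff', star_eq_conjTranspose, cayley, conjTranspose_mul,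
    conjTranspose_nonsing_inv]
  simp only [conjTranspose_sub, conjTranspose_add, conjTranspose_one, hS, sub_neg_eq_add]
  have hc : (1 + S)⁻¹ * (1 - S)⁻¹ = (1 - S)⁻¹ * (1 + S)⁻¹ := by
    rw [← Matrix.mul_inv_rev, ← Matrix.mul_inv_rev]; congr 1; noncomm_ring
  rw [← sub_eq_add_neg, mul_assoc, ← mul_assoc _ _ (1 + S), hc, mul_assoc, nonsing_inv_mul _ h2,
    mul_one, mul_nonsing_inv _ h1]

theorem contDiffAt_cayley {S : Matrix n n ℂ} (hS : Sᴴ = -S) {k : WithTop ℕ∞} :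
    ContDiffAt ℝ k cayley S :=
  ((contDiffAt_const.sub contDiffAt_id).matrix_inv (isUnit_one_sub_of_skew hS)).matrix_mul
    (contDiffAt_const.add contDiffAt_id)

theorem skew_smul {S : Matrix n n ℂ} (hS : Sᴴ = -S) (t : ℝ) : (t • S)ᴴ = -(t • S) := by
  simp [conjTranspose_smul, hS]

/-- The curve `t ↦ cayley (t S / 2) U` in the unitary group has velocity `S U` at time `0`. -/
theorem isCurveThrough_cayley {S U : Matrix n n ℂ} (hS : Sᴴ = -S)
    (hU : U ∈ unitaryGroup n ℂ) :
    IsCurveThrough {V | V ∈ unitaryGroup n ℂ} U (fun t => cayley ((t / 2) • S) * U) ∧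
      HasDerivAt (fun t : ℝ => cayley ((t / 2) • S) * U) (S * U) 0 := by
  have hlin : ContDiff ℝ ∞ fun t : ℝ => (t / 2) • S :=
    (contDiff_id.div_const 2).smul contDiff_const
  have hc : ∀ t : ℝ, ContDiffAt ℝ ∞ (fun t : ℝ => cayley ((t / 2) • S)) t := fun t =>
    ContDiffAt.comp (g := cayley) t (contDiffAt_cayley (skew_smul hS (t / 2))) hlin.contDiffAt
  refine ⟨⟨contDiff_iff_contDiffAt.2 fun t => (hc t).matrix_mul contDiffAt_const,
    fun t => mul_mem (cayley_mem_unitaryGroup (skew_smul hS _)) hU, by simp [cayley_zero]⟩, ?_⟩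
  have hd : HasDerivAt (fun t : ℝ => cayley ((t / 2) • S))
      (deriv (fun t : ℝ => cayley ((t / 2) • S)) 0) 0 :=
    ((hc 0).differentiableAt (by simp)).hasDerivAt
  set c' := deriv (fun t : ℝ => cayley ((t / 2) • S)) 0
  have hl : HasDerivAt (fun t : ℝ => (t / 2) • S) ((1 / 2 : ℝ) • S) 0 :=
    ((hasDerivAt_id (0 : ℝ)).div_const 2).smul_const S
  -- differentiate the identity `(1 - t S / 2) * cayley (t S / 2) = 1 + t S / 2`
  have e1 := (hl.const_sub 1).matrix_mul hd
  have e2 := hl.const_add 1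
  have e3 := (e1.congr_of_eventuallyEq (f₁ := fun t : ℝ => 1 + (t / 2) • S) (.of_forall fun t =>
    (one_sub_mul_cayley (skew_smul hS (t / 2))).symm)).unique e2
  have e4 : c' = S := by
    simp [cayley_zero] at e3
    have : c' = (2⁻¹ : ℝ) • S + (2⁻¹ : ℝ) • S := by
      rw [← sub_eq_add_neg, sub_eq_iff_eq_add] at e3; exact e3
    rw [this, ← add_smul]; norm_num
  have := hd.matrix_mul (hasDerivAt_const (0 : ℝ) U)
  simpa [e4] using this

end Cayley

/-! ### Smooth local sections of `U ↦ U A` -/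

section LocalSection

/-- The set of unitary matrices. -/
abbrev unitaries (n : Type*) [Fintype n] [DecidableEq n] : Set (Matrix n n ℂ) :=
  {V | V ∈ unitaryGroup n ℂ}

/-- The orbit of `A` under left multiplication by unitary matrices. -/
abbrev orbit (A : Matrix n n ℂ) : Set (Matrix n n ℂ) :=
  (fun U => U * A) '' unitaries n

/-- `A` is Hermitian, and `B` is a Hermitian generalized inverse that commutes with it, such as
the Moore-Penrose inverse. Then `A * B` is the orthogonal projection onto the range of `A`. -/
structure IsHermitianPseudoInverse (A B : Matrix n n ℂ) : Prop where
  left : Aᴴ = A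
  right : Bᴴ = B
  comm : A * B = B * A
  mul_mul : A * B * A = A

/-- For a partial isometry `Z` with initial projection `p`, close to `p`, a skew-Hermitian `S` with
`S (Z + p) = Z - p`, which says that the Cayley transform of `S` carries `p` to `Z`. With the
pseudoinverse `q = ((Z + p)ᴴ (Z + p) + 4 (1 - p))⁻¹ (Z + p)ᴴ` of `Z + p`, it is the matrix
`(Z - p) q - qᴴ (Z - p)ᴴ (1 - (Z + p) q)`. The summand `4 (1 - p)` makes the matrix to be inverted
equal to `4` at `Z = p`. -/
noncomputable def rotationGenerator (p Z : Matrix n n ℂ) : Matrix n n ℂ :=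
  (Z - p) * (((Z + p)ᴴ * (Z + p) + 4 * (1 - p))⁻¹ * (Z + p)ᴴ) -
    (((Z + p)ᴴ * (Z + p) + 4 * (1 - p))⁻¹ * (Z + p)ᴴ)ᴴ * (Z - p)ᴴ *
      (1 - (Z + p) * (((Z + p)ᴴ * (Z + p) + 4 * (1 - p))⁻¹ * (Z + p)ᴴ))

theorem cayley_rotationGenerator {p Z : Matrix n n ℂ} (hp : pᴴ = p) (hpp : p * p = p)
    (hZp : Z * p = Z) (hZZ : Zᴴ * Z = p) (hN : IsUnit ((Z + p)ᴴ * (Z + p) + 4 * (1 - p))) :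
    (rotationGenerator p Z)ᴴ = -rotationGenerator p Z ∧
      cayley (rotationGenerator p Z) * p = Z := by
  set b := Z + p with hb
  set c := Z - p with hc
  set M := bᴴ * b + 4 * (1 - p) with hM
  have hdet := (isUnit_iff_isUnit_det _).1 hN
  have hbp : b * p = b := by rw [hb, add_mul, hZp, hpp]
  have hcp : c * p = c := by rw [hc, sub_mul, hZp, hpp]
  have hMp : M * p = bᴴ * b := by
    rw [hM, add_mul, mul_assoc, hbp, mul_assoc, sub_mul, hpp]; simp
  have hq : (M⁻¹ * bᴴ) * b = p := by
    rw [mul_assoc, ← hMp, nonsing_inv_mul_cancel_left _ _ hdet]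
  have hskew : bᴴ * c = -(cᴴ * b) := by
    simp only [hb, hc, conjTranspose_add, conjTranspose_sub, hp, add_mul, sub_mul, mul_add,
      mul_sub, hZZ, hpp]
    abel
  have hS : rotationGenerator p Z =
      c * (M⁻¹ * bᴴ) - (M⁻¹ * bᴴ)ᴴ * cᴴ * (1 - b * (M⁻¹ * bᴴ)) := rfl
  rw [hS]
  generalize M⁻¹ * bᴴ = q at hq
  have hskew' : (c * q - qᴴ * cᴴ * (1 - b * q))ᴴ = -(c * q - qᴴ * cᴴ * (1 - b * q)) := by
    have e : qᴴ * bᴴ * (c * q) = -(qᴴ * cᴴ * (b * q)) := by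
      rw [mul_assoc, ← mul_assoc bᴴ, hskew]; noncomm_ring
    simp only [conjTranspose_sub, conjTranspose_mul, conjTranspose_conjTranspose, e,
      mul_sub, mul_one]
    abel
  refine ⟨hskew', ?_⟩
  have hSb : (c * q - qᴴ * cᴴ * (1 - b * q)) * b = c := by
    have hbqb : b * q * b = b := by rw [mul_assoc, hq, hbp]
    rw [sub_mul, mul_assoc c, hq, hcp, mul_assoc _ _ b, sub_mul, hbqb]; simp
  generalize c * q - qᴴ * cᴴ * (1 - b * q) = S at hskew' hSb
  have h2 : (1 + S) * p = (1 - S) * Z := by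
    have : S * p + S * Z = Z - p := by rw [← mul_add, add_comm p, ← hb, hSb]
    rw [add_mul, sub_mul, one_mul, one_mul, eq_sub_iff_add_eq, add_assoc, this]; abel
  rw [cayley, mul_assoc, h2, nonsing_inv_mul_cancel_left]
  exact (isUnit_iff_isUnit_det _).1 (isUnit_one_sub_of_skew hskew')

/-- The map `U ↦ U A` from the unitary group onto the orbit of `A` has smooth local sections. -/
theorem exists_local_section {A B U : Matrix n n ℂ} (h : IsHermitianPseudoInverse A B)
    (hU : U ∈ unitaries n) :
    ∃ s : Matrix n n ℂ → Matrix n n ℂ, ContDiffAt ℝ ∞ s (U * A) ∧ s (U * A) = U ∧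
      ∀ᶠ X in 𝓝 (U * A), X ∈ orbit A → s X ∈ unitaries n ∧ s X * A = X := by
  have hUU : Uᴴ * U = 1 := mem_unitaryGroup_iff'.1 hU
  have hUU' : U * Uᴴ = 1 := mem_unitaryGroup_iff.1 hU
  set p := A * B with hp_def
  have hp : pᴴ = p := by rw [hp_def, conjTranspose_mul, h.left, h.right, h.comm]
  have hpp : p * p = p := by rw [hp_def, ← mul_assoc, h.mul_mul]
  have hpA : p * A = A := h.mul_mul
  set Z : Matrix n n ℂ → Matrix n n ℂ := fun X => Uᴴ * X * B with hZ
  have hZ0 : Z (U * A) = p := by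
    simp only [hZ]; rw [← mul_assoc, hUU, one_mul]
  have hZs : ∀ X, ContDiffAt ℝ ∞ Z X := fun X =>
    (contDiffAt_const.matrix_mul contDiffAt_id).matrix_mul contDiffAt_const
  set M : Matrix n n ℂ → Matrix n n ℂ := fun X => (Z X + p)ᴴ * (Z X + p) + 4 * (1 - p) with hM
  have hZps : ∀ X, ContDiffAt ℝ ∞ (fun X => Z X + p) X := fun X => (hZs X).add contDiffAt_const
  have hMs : ∀ X, ContDiffAt ℝ ∞ M X := fun X =>
    ((hZps X).matrix_conjTranspose.matrix_mul (hZps X)).add contDiffAt_const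
  have hM0 : IsUnit (M (U * A)) := by
    have : M (U * A) = (4 : ℂ) • (1 : Matrix n n ℂ) := by
      rw [← Algebra.algebraMap_eq_smul_one, map_ofNat]
      simp only [hM, hZ0, conjTranspose_add, hp, add_mul, mul_add, hpp]
      noncomm_ring
      simp
    rw [this, isUnit_iff_isUnit_det, det_smul]
    simp
  have hMev : ∀ᶠ X in 𝓝 (U * A), IsUnit (M X) := by
    have hd : ContinuousAt (fun X => (M X).det) (U * A) :=
      ((hMs (U * A)).matrix_det).continuousAt
    filter_upwards [hd.eventually_ne ((isUnit_iff_isUnit_det _).1 hM0).ne_zero] with X hX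
    exact (isUnit_iff_isUnit_det _).2 hX.isUnit
  have hQs : ContDiffAt ℝ ∞ (fun X => (M X)⁻¹ * (Z X + p)ᴴ) (U * A) :=
    ((hMs _).matrix_inv hM0).matrix_mul (hZps _).matrix_conjTranspose
  have hcs : ContDiffAt ℝ ∞ (fun X => Z X - p) (U * A) := (hZs _).sub contDiffAt_const
  have hSs : ContDiffAt ℝ ∞ (fun X => rotationGenerator p (Z X)) (U * A) :=
    (hcs.matrix_mul hQs).sub
      ((hQs.matrix_conjTranspose.matrix_mul hcs.matrix_conjTranspose).matrix_mul
        (contDiffAt_const.sub ((hZps _).matrix_mul hQs)))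
  have hS0 : rotationGenerator p (Z (U * A)) = 0 := by
    rw [hZ0]; simp [rotationGenerator]
  refine ⟨fun X => U * cayley (rotationGenerator p (Z X)), ?_, ?_, ?_⟩
  · refine contDiffAt_const.matrix_mul (ContDiffAt.comp (g := cayley) _ ?_ hSs)
    rw [hS0]
    exact contDiffAt_cayley (by simp)
  · simp only [hS0, cayley_zero, mul_one]
  · filter_upwards [hMev] with X hX hXK
    obtain ⟨V, hV, rfl⟩ := hXK
    have hVV : Vᴴ * V = 1 := mem_unitaryGroup_iff'.1 hV
    have hZV : Z (V * A) = Uᴴ * V * p := by simp only [hZ, hp_def, mul_assoc]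
    obtain ⟨h1, h2⟩ := cayley_rotationGenerator (Z := Z (V * A)) hp hpp
      (by rw [hZV, mul_assoc, hpp])
      (by
        rw [hZV]
        simp only [conjTranspose_mul, hp, conjTranspose_conjTranspose]
        rw [show p * (Vᴴ * U) * (Uᴴ * V * p) = p * (Vᴴ * (U * Uᴴ) * V) * p by
          simp only [mul_assoc], hUU', mul_one, hVV, mul_one, hpp]) hX
    refine ⟨mul_mem hU (cayley_mem_unitaryGroup h1), ?_⟩
    calc U * cayley (rotationGenerator p (Z (V * A))) * A
        = U * (cayley (rotationGenerator p (Z (V * A))) * p) * A := by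
          rw [mul_assoc, mul_assoc, mul_assoc, hpA]
      _ = V * A := by
          rw [h2, hZV, show U * (Uᴴ * V * p) * A = U * Uᴴ * V * (p * A) by simp only [mul_assoc],
            hUU', one_mul, hpA]

end LocalSection

/-! ### First and second order behaviour of the landscapes along curves -/

section Landscape

/-- The function `X ↦ Re Tr (X P X† Θ)`, of which both landscapes are instances. -/
noncomputable def traceForm (P Θ X : Matrix n n ℂ) : ℝ := reTrace n (X * P * Xᴴ * Θ)

theorem continuous_traceForm (P Θ : Matrix n n ℂ) : Continuous (traceForm P Θ) :=
  continuous_reTrace.comp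
    (((continuous_id.matrix_mul continuous_const).matrix_mul
      continuous_id.matrix_conjTranspose).matrix_mul continuous_const)

theorem traceForm_mul {A P R Θ : Matrix n n ℂ} (hA : Aᴴ = A) (hP : A * R * A = P)
    (U : Matrix n n ℂ) : traceForm R Θ (U * A) = traceForm P Θ U := by
  simp only [traceForm, conjTranspose_mul, hA, ← hP, mul_assoc]

theorem hasDerivAt_traceForm {P Θ : Matrix n n ℂ} (hP : Pᴴ = P) (hΘ : Θᴴ = Θ)
    {γ : ℝ → Matrix n n ℂ} {v : Matrix n n ℂ} {t : ℝ} (h : HasDerivAt γ v t) :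
    HasDerivAt (traceForm P Θ ∘ γ) (2 * reTrace n (v * P * (γ t)ᴴ * Θ)) t := by
  have h2 : HasDerivAt (traceForm P Θ ∘ γ) _ t :=
    (((h.matrix_mul (hasDerivAt_const t P)).matrix_mul
      h.matrix_conjTranspose).matrix_mul (hasDerivAt_const t Θ)).reTrace
  refine h2.congr_deriv ?_
  have e : reTrace n (γ t * P * vᴴ * Θ) = reTrace n (v * P * (γ t)ᴴ * Θ) := by
    rw [← reTrace_conjTranspose]
    simp only [conjTranspose_mul, conjTranspose_conjTranspose, hP, hΘ]
    rw [reTrace_mul_comm]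
    simp only [mul_assoc]
  simp only [mul_zero, zero_add, add_mul, map_add, e]
  ring

/-- `U` is stationary: the derivative of `traceForm P Θ` vanishes on the tangent vectors `S U`
(`S` skew-Hermitian) of the unitary group. -/
def IsStationary (P Θ U : Matrix n n ℂ) : Prop :=
  ∀ S : Matrix n n ℂ, Sᴴ = -S → reTrace n (S * U * P * Uᴴ * Θ) = 0

/-- The bilinear form whose quadratic form is the Hessian of `traceForm P Θ` at the stationary
unitary `U`. The second summand comes from the curvature of the unitary group: a curve with
velocity `v` at `U` has acceleration `-v v† U` up to a tangent vector. -/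
noncomputable def hessianBilin (P Θ U : Matrix n n ℂ) :
    LinearMap.BilinMap ℝ (Matrix n n ℂ) ℝ :=
  LinearMap.mk₂ ℝ
    (fun v w => 2 * reTrace n (v * P * wᴴ * Θ) - 2 * reTrace n (v * wᴴ * U * P * Uᴴ * Θ))
    (fun v v' w => by simp only [add_mul, map_add]; ring)
    (fun c v w => by simp only [smul_mul_assoc, map_smul, smul_eq_mul]; ring)
    (fun v w w' => by simp only [conjTranspose_add, mul_add, add_mul, map_add]; ring)
    (fun c v w => by
      simp only [conjTranspose_smul, star_trivial, mul_smul_comm, smul_mul_assoc, map_smul,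
        smul_eq_mul]
      ring)

/-- The Hessian of `traceForm P Θ` at the stationary unitary `U`, as a quadratic form on the
space of all matrices. -/
noncomputable def hessianForm (P Θ U : Matrix n n ℂ) : QuadraticForm ℝ (Matrix n n ℂ) :=
  (hessianBilin P Θ U).toQuadraticMap

/-- `γ` is near time `0` a smooth curve in the unitary group through `U`. -/
structure IsUnitaryGerm (U : Matrix n n ℂ) (γ : ℝ → Matrix n n ℂ) : Prop where
  contDiffAt : ContDiffAt ℝ ∞ γ 0
  eventually_mem : ∀ᶠ t in 𝓝 0, γ t ∈ unitaries n
  map_zero : γ 0 = U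

theorem IsCurveThrough.isUnitaryGerm {U : Matrix n n ℂ} {γ : ℝ → Matrix n n ℂ}
    (h : IsCurveThrough (unitaries n) U γ) : IsUnitaryGerm U γ :=
  ⟨h.1.contDiffAt, .of_forall h.2.1, h.2.2⟩

namespace IsUnitaryGerm

variable {U : Matrix n n ℂ} {γ : ℝ → Matrix n n ℂ}

theorem eventually_hasDerivAt (h : IsUnitaryGerm U γ) :
    ∀ᶠ t in 𝓝 0, HasDerivAt γ (deriv γ t) t := by
  have h1 : ContDiffAt ℝ 1 γ 0 := h.contDiffAt.of_le (by simp)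
  filter_upwards [h1.eventually (by simp)] with t ht
  exact (ht.differentiableAt (by simp)).hasDerivAt

theorem hasDerivAt_deriv (h : IsUnitaryGerm U γ) :
    HasDerivAt (deriv γ) (deriv (deriv γ) 0) 0 :=
  hasDerivAt_deriv_of_contDiffAt h.contDiffAt

/-- The derivative of the identity `γ γ† = 1`. -/
theorem eventually_deriv_mul (h : IsUnitaryGerm U γ) :
    ∀ᶠ t in 𝓝 0, γ t * (deriv γ t)ᴴ + deriv γ t * (γ t)ᴴ = 0 := by
  filter_upwards [h.eventually_hasDerivAt, h.eventually_mem.eventually_nhds] with t ht hm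
  have h1 := ht.matrix_mul ht.matrix_conjTranspose
  refine h1.unique ((hasDerivAt_const t (1 : Matrix n n ℂ)).congr_of_eventuallyEq ?_)
  filter_upwards [hm] with u hu
  exact mem_unitaryGroup_iff.1 hu

theorem exists_deriv_eq (h : IsUnitaryGerm U γ) : ∃ S : Matrix n n ℂ, Sᴴ = -S ∧
    deriv γ 0 = S * U := by
  have h0 := h.eventually_deriv_mul.self_of_nhds
  have hU := h.eventually_mem.self_of_nhds
  rw [h.map_zero] at h0 hU
  refine ⟨deriv γ 0 * Uᴴ, ?_, ?_⟩
  · rw [conjTranspose_mul, conjTranspose_conjTranspose]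
    exact eq_neg_of_add_eq_zero_left h0
  · rw [mul_assoc, show Uᴴ * U = 1 from mem_unitaryGroup_iff'.1 hU, mul_one]

theorem deriv_traceForm (h : IsUnitaryGerm U γ) {P Θ : Matrix n n ℂ} (hP : Pᴴ = P)
    (hΘ : Θᴴ = Θ) : deriv (traceForm P Θ ∘ γ) 0 = 2 * reTrace n (deriv γ 0 * P * Uᴴ * Θ) := by
  rw [(hasDerivAt_traceForm hP hΘ h.eventually_hasDerivAt.self_of_nhds).deriv, h.map_zero]

theorem deriv_traceForm_eq_zero (h : IsUnitaryGerm U γ) {P Θ : Matrix n n ℂ} (hP : Pᴴ = P)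
    (hΘ : Θᴴ = Θ) (hs : IsStationary P Θ U) : deriv (traceForm P Θ ∘ γ) 0 = 0 := by
  obtain ⟨S, hS, hSU⟩ := h.exists_deriv_eq
  rw [h.deriv_traceForm hP hΘ, hSU, hs S hS, mul_zero]

theorem iteratedDeriv_traceForm (h : IsUnitaryGerm U γ) {P Θ : Matrix n n ℂ} (hP : Pᴴ = P)
    (hΘ : Θᴴ = Θ) (hs : IsStationary P Θ U) :
    iteratedDeriv 2 (traceForm P Θ ∘ γ) 0 = hessianForm P Θ U (deriv γ 0) := by
  have hU := h.eventually_mem.self_of_nhds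
  have hd0 := h.eventually_hasDerivAt.self_of_nhds
  have hd1 := h.hasDerivAt_deriv
  rw [h.map_zero] at hU
  have hUU : Uᴴ * U = 1 := mem_unitaryGroup_iff'.1 hU
  have e1 : deriv (traceForm P Θ ∘ γ) =ᶠ[𝓝 0]
      fun t => 2 * reTrace n (deriv γ t * P * (γ t)ᴴ * Θ) := by
    filter_upwards [h.eventually_hasDerivAt] with t ht
    exact (hasDerivAt_traceForm hP hΘ ht).deriv
  have e2 : HasDerivAt (fun t => 2 * reTrace n (deriv γ t * P * (γ t)ᴴ * Θ)) _ 0 :=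
    (((hd1.matrix_mul (hasDerivAt_const 0 P)).matrix_mul
      hd0.matrix_conjTranspose).matrix_mul (hasDerivAt_const 0 Θ)).reTrace.const_mul 2
  rw [iteratedDeriv_succ, iteratedDeriv_one, e1.deriv_eq]
  rw [e2.deriv]
  -- the acceleration is `T U - v v† U` with `T` skew-Hermitian
  have e3 := ((hd0.matrix_mul hd1.matrix_conjTranspose).add
    (hd1.matrix_mul hd0.matrix_conjTranspose)).unique
      ((hasDerivAt_const 0 (0 : Matrix n n ℂ)).congr_of_eventuallyEq h.eventually_deriv_mul)
  rw [h.map_zero] at e3 ⊢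
  generalize deriv (deriv γ) 0 = a at e3
  generalize deriv γ 0 = v at e3
  have hT : (a * Uᴴ + v * vᴴ)ᴴ = -(a * Uᴴ + v * vᴴ) := by
    simp only [conjTranspose_add, conjTranspose_mul, conjTranspose_conjTranspose]
    rw [← sub_eq_zero, ← e3]
    abel
  have e4 := hs _ hT
  have e5 : (a * Uᴴ + v * vᴴ) * U = a + v * vᴴ * U := by
    rw [add_mul, mul_assoc, hUU, mul_one]
  rw [e5] at e4
  simp only [add_mul, map_add] at e4
  simp only [hessianForm, LinearMap.BilinMap.toQuadraticMap_apply, hessianBilin,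
    LinearMap.mk₂_apply, mul_zero, zero_add, add_mul, map_add]
  linarith

end IsUnitaryGerm

theorem isCriticalOn_unitaries_iff {P Θ U : Matrix n n ℂ} (hP : Pᴴ = P) (hΘ : Θᴴ = Θ)
    (hU : U ∈ unitaries n) :
    IsCriticalOn (traceForm P Θ) (unitaries n) U ↔ IsStationary P Θ U := by
  refine ⟨fun h S hS => ?_, fun h => ⟨hU, fun γ hγ => ?_⟩⟩
  · obtain ⟨h1, h2⟩ := isCurveThrough_cayley hS hU
    have := h.2 _ h1
    rw [h1.isUnitaryGerm.deriv_traceForm hP hΘ] at this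
    erw [h2.deriv] at this
    simpa using this
  · exact hγ.isUnitaryGerm.deriv_traceForm_eq_zero hP hΘ h

end Landscape

/-! ### Lifting curves from the orbit to the unitary group -/

section Lifting

variable {A B P R Θ U : Matrix n n ℂ}

/-- Right multiplication by `A` maps curves in the unitary group to curves in the orbit. -/
theorem IsCurveThrough.mul_right {γ : ℝ → Matrix n n ℂ}
    (h : IsCurveThrough (unitaries n) U γ) (A : Matrix n n ℂ) :
    IsCurveThrough (orbit A) (U * A) (fun t => γ t * A) :=
  ⟨contDiff_iff_contDiffAt.2 fun _ => h.1.contDiffAt.matrix_mul contDiffAt_const,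
    fun t => ⟨γ t, h.2.1 t, rfl⟩, by simp [h.2.2]⟩

theorem IsCurveThrough.hasDerivAt {E : Type*} [NormedAddCommGroup E] [NormedSpace ℝ E]
    {M : Set E} {x : E} {γ : ℝ → E} (h : IsCurveThrough M x γ) :
    HasDerivAt γ (deriv γ 0) 0 :=
  (h.1.differentiable (by simp)).differentiableAt.hasDerivAt

/-- A curve in the orbit lifts, near time `0`, to a curve in the unitary group, whose velocity
depends linearly on the velocity of the given curve. -/
theorem exists_lift (h : IsHermitianPseudoInverse A B) (hU : U ∈ unitaries n) :
    ∃ D : Matrix n n ℂ →ₗ[ℝ] Matrix n n ℂ, ∀ γ, IsCurveThrough (orbit A) (U * A) γ →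
      ∃ η, IsUnitaryGerm U η ∧ (∀ᶠ t in 𝓝 0, η t * A = γ t) ∧ deriv η 0 = D (deriv γ 0) := by
  obtain ⟨s, hs, hs0, hsU⟩ := exists_local_section h hU
  refine ⟨(fderiv ℝ s (U * A)).toLinearMap, fun γ hγ => ⟨s ∘ γ, ⟨?_, ?_, ?_⟩, ?_, ?_⟩⟩
  · refine ContDiffAt.comp (g := s) 0 ?_ hγ.1.contDiffAt
    rwa [hγ.2.2]
  · have := hγ.1.continuous.tendsto 0
    rw [hγ.2.2] at this
    filter_upwards [this.eventually hsU] with t ht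
    exact (ht (hγ.2.1 t)).1
  · simp [hγ.2.2, hs0]
  · have := hγ.1.continuous.tendsto 0
    rw [hγ.2.2] at this
    filter_upwards [this.eventually hsU] with t ht
    exact (ht (hγ.2.1 t)).2
  · have h1 : HasFDerivAt s (fderiv ℝ s (U * A)) (γ 0) := by
      rw [hγ.2.2]
      exact (hs.differentiableAt (by simp)).hasFDerivAt
    exact (h1.comp_hasDerivAt 0 hγ.hasDerivAt).deriv

theorem traceForm_comp_eventuallyEq (h : IsHermitianPseudoInverse A B) (hP : A * R * A = P)
    {γ η : ℝ → Matrix n n ℂ} (hη : ∀ᶠ t in 𝓝 0, η t * A = γ t) :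
    traceForm R Θ ∘ γ =ᶠ[𝓝 0] traceForm P Θ ∘ η := by
  filter_upwards [hη] with t ht
  rw [Function.comp_apply, Function.comp_apply, ← ht, traceForm_mul h.left hP]

theorem isCriticalOn_orbit_iff (h : IsHermitianPseudoInverse A B) (hAR : A * R * A = P)
    (hP : Pᴴ = P) (hΘ : Θᴴ = Θ) (hU : U ∈ unitaries n) :
    IsCriticalOn (traceForm R Θ) (orbit A) (U * A) ↔ IsStationary P Θ U := by
  refine ⟨fun hc => ?_, fun hs => ⟨⟨U, hU, rfl⟩, fun γ hγ => ?_⟩⟩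
  · rw [← isCriticalOn_unitaries_iff hP hΘ hU]
    refine ⟨hU, fun γ hγ => ?_⟩
    have e : traceForm R Θ ∘ (fun t => γ t * A) = traceForm P Θ ∘ γ :=
      funext fun t => traceForm_mul h.left hAR (γ t)
    rw [← e]
    exact hc.2 _ (hγ.mul_right A)
  · obtain ⟨D, hD⟩ := exists_lift h hU
    obtain ⟨η, hη, hηA, -⟩ := hD γ hγ
    rw [(traceForm_comp_eventuallyEq h hAR hηA).deriv_eq]
    exact hη.deriv_traceForm_eq_zero hP hΘ hs

/-- Local maxima descend along the local sections, and lift by continuity of `U ↦ U A`. -/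
theorem isLocalMaxOn_orbit_iff (h : IsHermitianPseudoInverse A B) (hAR : A * R * A = P)
    (hU : U ∈ unitaries n) :
    IsLocalMaxOn (traceForm P Θ) (unitaries n) U ↔
      IsLocalMaxOn (traceForm R Θ) (orbit A) (U * A) := by
  have e := traceForm_mul (Θ := Θ) h.left hAR
  constructor
  · intro hm
    obtain ⟨s, hs, hs0, hsU⟩ := exists_local_section h hU
    have hc : Tendsto s (𝓝 (U * A)) (𝓝 U) := by
      have := hs.continuousAt.tendsto
      rw [hs0] at this
      exact this
    have hm' := hc.eventually (eventually_nhdsWithin_iff.1 hm)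
    refine eventually_nhdsWithin_iff.2 ?_
    filter_upwards [hm', hsU] with X hX hXs hXA
    have := hX (hXs hXA).1
    rwa [← e, ← e, (hXs hXA).2] at this
  · intro hm
    have hc : Tendsto (fun V : Matrix n n ℂ => V * A) (𝓝 U) (𝓝 (U * A)) :=
      (continuous_id.matrix_mul continuous_const).tendsto U
    refine eventually_nhdsWithin_iff.2 ?_
    filter_upwards [hc.eventually (eventually_nhdsWithin_iff.1 hm)] with V hV hVU
    have := hV ⟨V, hVU, rfl⟩
    rwa [e, e] at this

theorem traceForm_neg (P Θ X : Matrix n n ℂ) : traceForm P (-Θ) X = -traceForm P Θ X := by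
  simp [traceForm]

theorem isLocalMaxOn_traceForm_neg {M : Set (Matrix n n ℂ)} :
    IsLocalMaxOn (traceForm P (-Θ)) M U ↔ IsLocalMinOn (traceForm P Θ) M U := by
  simp only [IsLocalMaxOn, IsMaxFilter, IsLocalMinOn, IsMinFilter, traceForm_neg, neg_le_neg_iff]

theorem isLocalMinOn_orbit_iff (h : IsHermitianPseudoInverse A B) (hAR : A * R * A = P)
    (hU : U ∈ unitaries n) :
    IsLocalMinOn (traceForm P Θ) (unitaries n) U ↔
      IsLocalMinOn (traceForm R Θ) (orbit A) (U * A) := by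
  rw [← isLocalMaxOn_traceForm_neg, ← isLocalMaxOn_traceForm_neg,
    isLocalMaxOn_orbit_iff h hAR hU]

end Lifting

/-! ### Hessians and their signatures -/

section Hessian

variable {A B P R Θ U : Matrix n n ℂ}

/-- The skew-Hermitian matrices, as a real vector space. -/
def skewHermitian (n : Type*) : Submodule ℝ (Matrix n n ℂ) where
  carrier := {S | Sᴴ = -S}
  zero_mem' := by simp
  add_mem' {S T} hS hT := by
    change (S + T)ᴴ = -(S + T)
    rw [conjTranspose_add, show Sᴴ = -S from hS, show Tᴴ = -T from hT, neg_add]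
  smul_mem' t S hS := by
    change (t • S)ᴴ = -(t • S)
    rw [conjTranspose_smul, show Sᴴ = -S from hS, star_trivial, smul_neg]

/-- Every tangent vector of the orbit of `A` at `U A` has the form `S U A` with `S`
skew-Hermitian; so the velocities of curves already form a vector space. -/
theorem exists_of_mem_tangentSpace (h : IsHermitianPseudoInverse A B) (hU : U ∈ unitaries n)
    {v : Matrix n n ℂ} (hv : v ∈ tangentSpace (orbit A) (U * A)) :
    ∃ S : Matrix n n ℂ, Sᴴ = -S ∧ v = S * U * A := by
  have hle : tangentSpace (orbit A) (U * A) ≤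
      (skewHermitian n).map (LinearMap.mulRight ℝ (U * A)) := by
    refine Submodule.span_le.2 ?_
    rintro _ ⟨γ, hγ, rfl⟩
    obtain ⟨D, hD⟩ := exists_lift h hU
    obtain ⟨η, hη, hηA, -⟩ := hD γ hγ
    obtain ⟨S, hS, hSU⟩ := hη.exists_deriv_eq
    refine ⟨S, hS, ?_⟩
    have h1 := hη.eventually_hasDerivAt.self_of_nhds.matrix_mul (hasDerivAt_const 0 A)
    have h2 := h1.congr_of_eventuallyEq (EventuallyEq.symm hηA)
    rw [h2.deriv, hSU, mul_zero, zero_add, LinearMap.mulRight_apply, mul_assoc]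
  obtain ⟨S, hS, rfl⟩ := hle hv
  exact ⟨S, hS, by rw [LinearMap.mulRight_apply, mul_assoc]⟩

theorem isHermitianPseudoInverse_one : IsHermitianPseudoInverse (1 : Matrix n n ℂ) 1 := by
  constructor <;> simp

theorem orbit_one : orbit (1 : Matrix n n ℂ) = unitaries n := by simp [orbit]

theorem exists_of_mem_tangentSpace_unitaries (hU : U ∈ unitaries n)
    {v : Matrix n n ℂ} (hv : v ∈ tangentSpace (unitaries n) U) :
    ∃ S : Matrix n n ℂ, Sᴴ = -S ∧ v = S * U := by
  have := exists_of_mem_tangentSpace (isHermitianPseudoInverse_one (n := n)) hU (v := v)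
  rw [orbit_one, mul_one] at this
  simpa using this hv

/-- If every tangent vector is the velocity of a curve, the Hessian is unique. -/
theorem IsHessianOn.unique {E : Type*} [NormedAddCommGroup E] [NormedSpace ℝ E] {f : E → ℝ}
    {M : Set E} {x : E} {Q Q' : QuadraticForm ℝ (tangentSpace M x)}
    (hM : ∀ v ∈ tangentSpace M x, ∃ γ, IsCurveThrough M x γ ∧ deriv γ 0 = v)
    (hQ : IsHessianOn f M x Q) (hQ' : IsHessianOn f M x Q') : Q = Q' := by
  ext ⟨v, hv⟩
  obtain ⟨γ, hγ, rfl⟩ := hM v hv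
  exact (hQ γ hγ).symm.trans (hQ' γ hγ)

theorem exists_curve_unitaries (hU : U ∈ unitaries n) {v : Matrix n n ℂ}
    (hv : v ∈ tangentSpace (unitaries n) U) :
    ∃ γ, IsCurveThrough (unitaries n) U γ ∧ deriv γ 0 = v := by
  obtain ⟨S, hS, rfl⟩ := exists_of_mem_tangentSpace_unitaries hU hv
  exact ⟨_, (isCurveThrough_cayley hS hU).1, (isCurveThrough_cayley hS hU).2.deriv⟩

theorem exists_curve_orbit (h : IsHermitianPseudoInverse A B) (hU : U ∈ unitaries n)
    {v : Matrix n n ℂ} (hv : v ∈ tangentSpace (orbit A) (U * A)) :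
    ∃ γ, IsCurveThrough (orbit A) (U * A) γ ∧ deriv γ 0 = v := by
  obtain ⟨S, hS, rfl⟩ := exists_of_mem_tangentSpace h hU hv
  obtain ⟨h1, h2⟩ := isCurveThrough_cayley hS hU
  refine ⟨_, h1.mul_right A, ?_⟩
  have := (h2.matrix_mul (hasDerivAt_const 0 A)).deriv
  rwa [mul_zero, zero_add] at this

theorem existsUnique_isHessianOn_unitaries (hP : Pᴴ = P) (hΘ : Θᴴ = Θ) (hU : U ∈ unitaries n)
    (hs : IsStationary P Θ U) : ∃! Q, IsHessianOn (traceForm P Θ) (unitaries n) U Q :=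
  ⟨(hessianForm P Θ U).comp (Submodule.subtype _),
    fun _ hγ => hγ.isUnitaryGerm.iteratedDeriv_traceForm hP hΘ hs,
    fun _ hQ => hQ.unique (fun _ => exists_curve_unitaries hU)
      fun _ hγ => hγ.isUnitaryGerm.iteratedDeriv_traceForm hP hΘ hs⟩

/-- On the orbit, the Hessian is obtained by composing the Hessian on the unitary group with the
differential of a local section. -/
theorem existsUnique_isHessianOn_orbit (h : IsHermitianPseudoInverse A B) (hAR : A * R * A = P)
    (hP : Pᴴ = P) (hΘ : Θᴴ = Θ) (hU : U ∈ unitaries n) (hs : IsStationary P Θ U) :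
    ∃! Q, IsHessianOn (traceForm R Θ) (orbit A) (U * A) Q := by
  obtain ⟨D, hD⟩ := exists_lift h hU
  have hQ : IsHessianOn (traceForm R Θ) (orbit A) (U * A)
      ((hessianForm P Θ U).comp (D ∘ₗ Submodule.subtype _)) := by
    intro γ hγ
    obtain ⟨η, hη, hηA, hηD⟩ := hD γ hγ
    rw [((traceForm_comp_eventuallyEq h hAR hηA).iteratedDeriv_eq 2),
      hη.iteratedDeriv_traceForm hP hΘ hs, hηD]
    rfl
  exact ⟨_, hQ, fun _ hQ' => hQ'.unique (fun _ => exists_curve_orbit h hU) hQ⟩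

/-- The positive index of inertia is invariant under pullback along a surjection. -/
theorem sigPos_comp_of_surjective {V W : Type*} [AddCommGroup V] [Module ℝ V]
    [FiniteDimensional ℝ V] [AddCommGroup W] [Module ℝ W] [FiniteDimensional ℝ W]
    (Q : QuadraticForm ℝ W) (f : V →ₗ[ℝ] W) (hf : Function.Surjective f) :
    sigPos (Q.comp f) = sigPos Q := by
  apply le_antisymm
  · obtain ⟨S, hS, hpos⟩ := exists_finrank_eq_sigPos_and_posDef (Q.comp f)
    -- `f` is injective on a subspace on which `Q ∘ f` is positive definite
    have hinj : Function.Injective (f.domRestrict S) := by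
      rw [← LinearMap.ker_eq_bot, LinearMap.ker_eq_bot']
      intro v hv
      by_contra hne
      have := hpos v hne
      have e : (Q.comp f).restrict S v = Q (f.domRestrict S v) := rfl
      rw [e, hv, QuadraticMap.map_zero] at this
      exact lt_irrefl _ this
    rw [← hS, ← LinearMap.finrank_range_of_inj hinj]
    refine le_sigPos_of_posDef Q ?_
    rintro ⟨_, v, rfl⟩ hne
    exact hpos v fun h0 => hne (Subtype.ext (by simp [h0]))
  · obtain ⟨S, hS, hpos⟩ := exists_finrank_eq_sigPos_and_posDef Q
    obtain ⟨g, hg⟩ := f.exists_rightInverse_of_surjective (LinearMap.range_eq_top.2 hf)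
    have hfg : ∀ w, f (g w) = w := fun w => LinearMap.congr_fun hg w
    have hinj : Function.Injective (g.domRestrict S) := by
      intro v w hvw
      have := congrArg f hvw
      exact Subtype.ext (by simpa [hfg] using this)
    rw [← hS, ← LinearMap.finrank_range_of_inj hinj]
    refine le_sigPos_of_posDef _ ?_
    rintro ⟨_, v, rfl⟩ hne
    change 0 < Q (f (g v))
    rw [hfg]
    exact hpos v fun h0 => hne (Subtype.ext (by simp [h0]))

theorem sigNeg_comp_of_surjective {V W : Type*} [AddCommGroup V] [Module ℝ V]
    [FiniteDimensional ℝ V] [AddCommGroup W] [Module ℝ W] [FiniteDimensional ℝ W]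
    (Q : QuadraticForm ℝ W) (f : V →ₗ[ℝ] W) (hf : Function.Surjective f) :
    sigNeg (Q.comp f) = sigNeg Q := by
  rw [← sigPos_neg, ← sigPos_neg, ← sigPos_comp_of_surjective (-Q) f hf]
  rfl

/-- The Hessian of the lifted function is the pullback of the Hessian on the orbit along the
surjective differential `v ↦ v A`, whence the equality of the signatures. -/
theorem signature_eq (h : IsHermitianPseudoInverse A B) (hAR : A * R * A = P)
    (hU : U ∈ unitaries n) {Q : QuadraticForm ℝ (tangentSpace (unitaries n) U)}
    {Q' : QuadraticForm ℝ (tangentSpace (orbit A) (U * A))}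
    (hQ : IsHessianOn (traceForm P Θ) (unitaries n) U Q)
    (hQ' : IsHessianOn (traceForm R Θ) (orbit A) (U * A) Q') :
    sigPos Q = sigPos Q' ∧ sigNeg Q = sigNeg Q' := by
  have hderiv : ∀ {γ}, IsCurveThrough (unitaries n) U γ →
      deriv (fun t => γ t * A) 0 = deriv γ 0 * A := fun {γ} hγ => by
    have := (hγ.hasDerivAt.matrix_mul (hasDerivAt_const 0 A)).deriv
    rwa [mul_zero, zero_add] at this
  have hmap : ∀ v ∈ tangentSpace (unitaries n) U,
      LinearMap.mulRight ℝ A v ∈ tangentSpace (orbit A) (U * A) := by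
    intro v hv
    obtain ⟨γ, hγ, rfl⟩ := exists_curve_unitaries hU hv
    exact Submodule.subset_span ⟨_, hγ.mul_right A, hderiv hγ⟩
  set π := (LinearMap.mulRight ℝ A).restrict hmap with hπ
  have hsurj : Function.Surjective π := by
    rintro ⟨v, hv⟩
    obtain ⟨S, hS, rfl⟩ := exists_of_mem_tangentSpace h hU hv
    obtain ⟨h1, h2⟩ := isCurveThrough_cayley hS hU
    exact ⟨⟨S * U, Submodule.subset_span ⟨_, h1, h2.deriv⟩⟩, rfl⟩
  have hcomp : Q = Q'.comp π := by
    ext ⟨v, hv⟩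
    obtain ⟨γ, hγ, rfl⟩ := exists_curve_unitaries hU hv
    have e : traceForm R Θ ∘ (fun t => γ t * A) = traceForm P Θ ∘ γ :=
      funext fun t => traceForm_mul h.left hAR (γ t)
    have h1 := hQ γ hγ
    have h2 := hQ' _ (hγ.mul_right A)
    rw [e] at h2
    refine h1.symm.trans (h2.trans ?_)
    rw [QuadraticMap.comp_apply]
    congr 1
    exact Subtype.ext (hderiv hγ)
  rw [hcomp]
  exact ⟨sigPos_comp_of_surjective _ _ hsurj, sigNeg_comp_of_surjective _ _ hsurj⟩

end Hessian

/-! ### Connected components of the critical sets -/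

section Components

/-- A quotient map `S → T` with connected fibres induces a bijection of connected components. -/
theorem bijOn_components {X Y : Type*} [TopologicalSpace X] [TopologicalSpace Y] {S : Set X}
    {T : Set Y} {f : X → Y} (hf : Set.MapsTo f S T)
    (hq : IsQuotientMap (hf.restrict f S T))
    (hfib : ∀ y ∈ T, IsConnected (S ∩ f ⁻¹' {y})) :
    Set.BijOn (fun C => f '' C) (components S) (components T) := by
  set g := hf.restrict f S T
  have hg : ∀ y : T, IsConnected (g ⁻¹' {y}) := by
    rintro ⟨y, hy⟩
    have e : Subtype.val '' (g ⁻¹' {⟨y, hy⟩}) = S ∩ f ⁻¹' {y} := by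
      ext x
      constructor
      · rintro ⟨⟨x, hx⟩, hxy, rfl⟩
        exact ⟨hx, congrArg Subtype.val hxy⟩
      · rintro ⟨hx, hxy⟩
        exact ⟨⟨x, hx⟩, Subtype.ext hxy, rfl⟩
    have h := hfib y hy
    rw [← e] at h
    exact ⟨h.1.of_image, IsInducing.subtypeVal.isPreconnected_image.1 h.2⟩
  have himg : ∀ x (hx : x ∈ S), f '' connectedComponentIn S x = connectedComponentIn T (f x) := by
    intro x hx
    rw [connectedComponentIn_eq_image hx, connectedComponentIn_eq_image (hf hx),
      ← show g ⟨x, hx⟩ = ⟨f x, hf hx⟩ from rfl, ← hq.isCoinducing.image_connectedComponent hg,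
      Set.image_image, Set.image_image]
    rfl
  refine ⟨?_, ?_, ?_⟩
  · rintro _ ⟨x, hx, rfl⟩
    exact ⟨f x, hf hx, himg x hx⟩
  · rintro _ ⟨x, hx, rfl⟩ _ ⟨x', hx', rfl⟩ h
    simp only [himg x hx, himg x' hx'] at h
    have hx'T : f x' ∈ connectedComponentIn T (f x) := h ▸ mem_connectedComponentIn (hf hx')
    refine connectedComponentIn_eq ?_
    rw [connectedComponentIn_eq_image (hf hx)] at hx'T
    rw [connectedComponentIn_eq_image hx]
    obtain ⟨⟨y, hy⟩, hy1, rfl : y = f x'⟩ := hx'T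
    refine ⟨⟨x', hx'⟩, ?_, rfl⟩
    rw [← hq.isCoinducing.preimage_connectedComponent hg]
    exact hy1
  · rintro _ ⟨y, hy, rfl⟩
    obtain ⟨⟨x, hx⟩, hxy⟩ := hq.surjective ⟨y, hy⟩
    have : f x = y := congrArg Subtype.val hxy
    subst this
    exact ⟨_, ⟨x, hx, rfl⟩, himg x hx⟩

variable {A B P R Θ U V W : Matrix n n ℂ}

theorem isUnit_one_add_projection {p : Matrix n n ℂ} (hp : pᴴ = p) (hpp : p * p = p) :
    IsUnit (1 + p) := by
  have : p.PosSemidef := by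
    have := posSemidef_conjTranspose_mul_self p
    rwa [hp, hpp] at this
  exact (PosDef.one.add_posSemidef this).isUnit

/-- A unitary without the eigenvalue `-1` that fixes `A` is joined to `1` by the Cayley transforms
of the multiples of a skew-Hermitian matrix which annihilates `A`. -/
theorem exists_cayley_path (hV : V ∈ unitaries n) (hVA : V * A = A) (h : IsUnit (1 + V)) :
    ∃ t ⊆ {W ∈ unitaries n | W * A = A}, 1 ∈ t ∧ V ∈ t ∧ IsPreconnected t := by
  have hVV : Vᴴ * V = 1 := mem_unitaryGroup_iff'.1 hV
  have hVV' : V * Vᴴ = 1 := mem_unitaryGroup_iff.1 hV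
  have hdet := (isUnit_iff_isUnit_det _).1 h
  set S := (1 + V)⁻¹ * (V - 1) with hS
  have hS1 : (1 + V) * S = V - 1 := mul_nonsing_inv_cancel_left _ _ hdet
  have hdet' : IsUnit (1 + V)ᴴ.det := by rw [det_conjTranspose]; exact hdet.star
  have hS2 : Sᴴ * (1 + V)ᴴ = Vᴴ - 1 := by
    rw [← conjTranspose_mul, hS1, conjTranspose_sub, conjTranspose_one]
  have hskew : Sᴴ = -S := by
    -- multiply by `1 + V` on the left and by its conjugate transpose on the right
    have e : (1 + V) * (Sᴴ + S) * (1 + V)ᴴ = 0 := by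
      rw [mul_add, add_mul, hS1, mul_assoc, hS2, conjTranspose_add, conjTranspose_one]
      simp only [add_mul, mul_add, sub_mul, mul_sub, one_mul, mul_one, hVV']
      abel
    have e2 : Sᴴ + S = 0 := by
      have e3 := congrArg (fun X => (1 + V)⁻¹ * X * (1 + V)ᴴ⁻¹) e
      simp only [mul_zero, zero_mul] at e3
      rwa [mul_assoc (1 + V), nonsing_inv_mul_cancel_left _ _ hdet,
        mul_nonsing_inv_cancel_right _ _ hdet'] at e3
    exact eq_neg_of_add_eq_zero_left e2
  have hSA : S * A = 0 := by rw [hS, mul_assoc, sub_mul, hVA, one_mul, sub_self, mul_zero]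
  have hfix : ∀ t : ℝ, cayley (t • S) * A = A := by
    intro t
    have h1 : (1 + t • S) * A = (1 - t • S) * A := by
      rw [add_mul, sub_mul, smul_mul_assoc, hSA]; simp
    rw [cayley, mul_assoc, h1, nonsing_inv_mul_cancel_left]
    exact (isUnit_iff_isUnit_det _).1 (isUnit_one_sub_of_skew (skew_smul hskew t))
  have hcay : cayley S = V := by
    have h1 : (1 - S) * V = 1 + S := by
      have hVS : (1 + V) * ((1 - S) * V) = (1 + V) * (1 + S) := by
        rw [← mul_assoc, mul_sub, mul_add, hS1]; noncomm_ring
      have := congrArg (fun X => (1 + V)⁻¹ * X) hVS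
      simpa only [nonsing_inv_mul_cancel_left _ _ hdet] using this
    rw [cayley, ← h1, nonsing_inv_mul_cancel_left]
    exact (isUnit_iff_isUnit_det _).1 (isUnit_one_sub_of_skew hskew)
  refine ⟨Set.range fun t : ℝ => cayley (t • S), ?_, ⟨0, by simp [cayley_zero]⟩,
    ⟨1, by simp [hcay]⟩, ?_⟩
  · rintro _ ⟨t, rfl⟩
    exact ⟨cayley_mem_unitaryGroup (skew_smul hskew t), hfix t⟩
  · refine isPreconnected_range (continuous_iff_continuousAt.2 fun t => ?_)
    have hl : ContinuousAt (fun t : ℝ => t • S) t :=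
      (continuous_id.smul continuous_const).continuousAt
    exact ContinuousAt.comp (g := cayley)
      (contDiffAt_cayley (k := 0) (skew_smul hskew t)).continuousAt hl

/-- The stabilizer of `A` in the unitary group is connected. -/
theorem isConnected_stabilizer (h : IsHermitianPseudoInverse A B) :
    IsConnected {W ∈ unitaries n | W * A = A} := by
  have h1 : (1 : Matrix n n ℂ) ∈ {W ∈ unitaries n | W * A = A} := 
    ⟨show (1 : Matrix n n ℂ) ∈ unitaryGroup n ℂ from one_mem _, one_mul A⟩
  refine ⟨⟨1, h1⟩, isPreconnected_of_forall 1 ?_⟩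
  rintro W ⟨hW, hWA⟩
  have hWW : Wᴴ * W = 1 := mem_unitaryGroup_iff'.1 hW
  set p := A * B with hp_def
  have hp : pᴴ = p := by rw [hp_def, conjTranspose_mul, h.left, h.right, h.comm]
  have hpp : p * p = p := by rw [hp_def, ← mul_assoc, h.mul_mul]
  have hpA : p * A = A := h.mul_mul
  have hWp : W * p = p := by rw [hp_def, ← mul_assoc, hWA]
  have hWp' : Wᴴ * p = p := by
    calc Wᴴ * p = Wᴴ * (W * p) := by rw [hWp]
      _ = p := by rw [← mul_assoc, hWW, one_mul]
  have hpW : p * W = p := by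
    simpa [hp] using congrArg conjTranspose hWp'
  -- rotate the part of `W` on the kernel of `A` by a phase
  set F : ℂ → Matrix n n ℂ := fun z => p + z • (W - p) with hF
  have hFmem : ∀ z ∈ Metric.sphere (0 : ℂ) 1, F z ∈ {W ∈ unitaries n | W * A = A} := by
    intro z hz
    have hz' : (starRingEnd ℂ) z * z = 1 := by
      rw [mem_sphere_zero_iff_norm] at hz
      rw [mul_comm, Complex.mul_conj, Complex.normSq_eq_norm_sq, hz]; simp
    refine ⟨mem_unitaryGroup_iff'.2 ?_, ?_⟩
    · simp only [hF, star_eq_conjTranspose, conjTranspose_add, conjTranspose_smul,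
        conjTranspose_sub, hp, add_mul, mul_add, smul_mul_assoc, mul_smul_comm,
        sub_mul, mul_sub, hpp, hWW, hWp', hpW, sub_self, smul_zero, RCLike.star_def]
      rw [add_zero, add_sub_cancel_left, smul_smul, mul_comm z, hz', one_smul]
      abel
    · simp only [hF, add_mul, smul_mul_assoc, sub_mul, hWA, hpA, sub_self, smul_zero, add_zero]
  have hcirc : IsPreconnected (Metric.sphere (0 : ℂ) 1) :=
    isPreconnected_sphere (by rw [Complex.rank_real_complex]; norm_num) 0 1
  have hone : (1 : ℂ) ∈ Metric.sphere (0 : ℂ) 1 := by simp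
  -- `-1` is an eigenvalue of `F z` for finitely many `z` only
  obtain ⟨z, hz, hzu⟩ : ∃ z ∈ Metric.sphere (0 : ℂ) 1, IsUnit (1 + F z) := by
    open Polynomial in
    set q : ℂ[X] := ((1 + p).map C + (X : ℂ[X]) • (W - p).map C).det with hq
    have hqe : ∀ z, q.eval z = (1 + F z).det := by
      intro z
      rw [hq, ← Polynomial.coe_evalRingHom, RingHom.map_det]
      congr 1
      ext i j
      simp [hF, add_assoc]
    have hq0 : q ≠ 0 := by
      intro h0
      have := hqe 0
      rw [h0] at this
      simp only [hF, zero_smul, add_zero, Polynomial.eval_zero] at this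
      exact ((isUnit_iff_isUnit_det _).1 (isUnit_one_add_projection hp hpp)).ne_zero this.symm
    have hinf : (Metric.sphere (0 : ℂ) 1).Infinite :=
      hcirc.infinite_of_nontrivial ⟨1, hone, -1, by simp, by norm_num⟩
    obtain ⟨z, hz, hzq⟩ := hinf.exists_notMem_finset q.roots.toFinset
    refine ⟨z, hz, (isUnit_iff_isUnit_det _).2 (Ne.isUnit fun h0 => hzq ?_)⟩
    rw [Multiset.mem_toFinset, Polynomial.mem_roots hq0, Polynomial.IsRoot, hqe, h0]
  obtain ⟨t, ht, ht1, htz, htc⟩ := exists_cayley_path (hFmem z hz).1 (hFmem z hz).2 hzu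
  refine ⟨t ∪ F '' Metric.sphere 0 1, Set.union_subset ht (Set.image_subset_iff.2 hFmem),
    .inl ht1, .inr ⟨1, hone, by simp [hF]⟩, ?_⟩
  refine IsPreconnected.union (F z) htz ⟨z, hz, rfl⟩ htc (hcirc.image _ ?_)
  exact (continuous_const.add (continuous_id.smul continuous_const)).continuousOn

/-- The fibres of `U ↦ U A` are cosets of the stabilizer of `A`. -/
theorem isConnected_fiber (h : IsHermitianPseudoInverse A B) (hU : U ∈ unitaries n) :
    IsConnected (unitaries n ∩ (fun V => V * A) ⁻¹' {U * A}) := by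
  have hUU : Uᴴ * U = 1 := mem_unitaryGroup_iff'.1 hU
  have hUU' : U * Uᴴ = 1 := mem_unitaryGroup_iff.1 hU
  have e : unitaries n ∩ (fun V => V * A) ⁻¹' {U * A} =
      (fun W => U * W) '' {W ∈ unitaries n | W * A = A} := by
    ext V
    constructor
    · rintro ⟨hV, hVA : V * A = U * A⟩
      have hUV : Uᴴ * V ∈ unitaryGroup n ℂ := mul_mem (Unitary.star_mem hU) hV
      refine ⟨Uᴴ * V, ⟨hUV, ?_⟩, ?_⟩
      · rw [mul_assoc, hVA, ← mul_assoc, hUU, one_mul]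
      · simp only [← mul_assoc, hUU', one_mul]
    · rintro ⟨W, ⟨hW, hWA⟩, rfl⟩
      refine ⟨show U * W ∈ unitaryGroup n ℂ from mul_mem hU hW, ?_⟩
      simp only [Set.mem_preimage, Set.mem_singleton_iff, mul_assoc, hWA]
  rw [e]
  exact (isConnected_stabilizer h).image _ (continuous_const.matrix_mul continuous_id).continuousOn

theorem isCompact_unitaries : IsCompact (unitaries n) := by
  refine Metric.isCompact_of_isClosed_isBounded ?_ ?_
  · have : unitaries n = (fun U : Matrix n n ℂ => U * Uᴴ) ⁻¹' {1} := by
      ext U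
      exact mem_unitaryGroup_iff
    rw [this]
    exact isClosed_singleton.preimage (continuous_id.matrix_mul continuous_id.matrix_conjTranspose)
  · refine (Metric.isBounded_closedBall (x := (0 : Matrix n n ℂ)) (r := 1)).subset fun U hU => ?_
    rw [mem_closedBall_zero_iff]
    exact entrywise_sup_norm_bound_of_unitary hU

theorem isCompact_criticalSet (hP : Pᴴ = P) (hΘ : Θᴴ = Θ) :
    IsCompact (criticalSet (traceForm P Θ) (unitaries n)) := by
  have e : criticalSet (traceForm P Θ) (unitaries n) =
      unitaries n ∩ {U | IsStationary P Θ U} := by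
    ext U
    refine ⟨fun h => ⟨h.1, (isCriticalOn_unitaries_iff hP hΘ h.1).1 h⟩,
      fun h => (isCriticalOn_unitaries_iff hP hΘ h.1).2 h.2⟩
  rw [e]
  refine isCompact_unitaries.inter_right ?_
  simp only [IsStationary, Set.ofPred_forall]
  refine isClosed_iInter fun S => isClosed_iInter fun _ => isClosed_eq ?_ continuous_const
  exact continuous_reTrace.comp ((((continuous_const.matrix_mul continuous_id).matrix_mul
    continuous_const).matrix_mul continuous_id.matrix_conjTranspose).matrix_mul continuous_const)

theorem bijOn_components_criticalSet (h : IsHermitianPseudoInverse A B) (hAR : A * R * A = P)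
    (hP : Pᴴ = P) (hΘ : Θᴴ = Θ) :
    Set.BijOn (fun C => (fun U => U * A) '' C)
      (components (criticalSet (traceForm P Θ) (unitaries n)))
      (components (criticalSet (traceForm R Θ) (orbit A))) := by
  have hiff : ∀ {U}, U ∈ unitaries n → (U ∈ criticalSet (traceForm P Θ) (unitaries n) ↔
      U * A ∈ criticalSet (traceForm R Θ) (orbit A)) := fun hU =>
    (isCriticalOn_unitaries_iff hP hΘ hU).trans (isCriticalOn_orbit_iff h hAR hP hΘ hU).symm
  have hmaps : Set.MapsTo (fun U => U * A) (criticalSet (traceForm P Θ) (unitaries n))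
      (criticalSet (traceForm R Θ) (orbit A)) := fun U hU => (hiff hU.1).1 hU
  refine bijOn_components hmaps ?_ ?_
  · have := isCompact_iff_compactSpace.1 (isCompact_criticalSet hP hΘ)
    have hc : Continuous (hmaps.restrict (fun U => U * A) _ _) :=
      (continuous_id.matrix_mul continuous_const).continuousOn.mapsToRestrict hmaps
    refine hc.isClosedMap.isQuotientMap hc ?_
    rintro ⟨K, hK⟩
    obtain ⟨U, hU, rfl⟩ := hK.1
    exact ⟨⟨U, (hiff hU).2 hK⟩, rfl⟩
  · intro K hK
    obtain ⟨U, hU, rfl⟩ := hK.1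
    convert isConnected_fiber h hU using 1
    ext V
    refine ⟨fun hV => ⟨hV.1.1, hV.2⟩, fun hV => ⟨(hiff hV.1).2 ?_, hV.2⟩⟩
    rw [show V * A = U * A from hV.2]
    exact hK

end Components

/-! ### Simultaneous diagonalization of commuting Hermitian matrices -/

section Diagonalization

theorem exists_eq_unitary_mul_diagonal {A : Matrix n n ℂ} (hA : Aᴴ = A) :
    ∃ V ∈ unitaryGroup n ℂ, ∃ d : n → ℝ, A = V * diagonal (fun i => (d i : ℂ)) * Vᴴ := by
  have h : A.IsHermitian := hA
  refine ⟨h.eigenvectorUnitary, h.eigenvectorUnitary.2, h.eigenvalues, ?_⟩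
  have := h.spectral_theorem
  rw [Unitary.conjStarAlgAut_apply] at this
  exact this

/-- An eigenvector `w` of `T + t D` (`D` diagonal with entries `d`, commuting with `T`) splits into
its components on the level sets of `d`, and these are eigenvectors of `T`. -/
theorem mem_spectrum_of_mulVec {T : Matrix n n ℂ} {d : n → ℝ}
    (hT : ∀ i j, d i ≠ d j → T i j = 0) {t c : ℝ} {w : n → ℂ}
    (hw : ∀ i, (T *ᵥ w) i + t * d i * w i = c * w i) {i : n} (hi : w i ≠ 0) :
    ((c - t * d i : ℝ) : ℂ) ∈ spectrum ℂ T := by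
  set u : n → ℂ := fun j => if d j = d i then w j else 0 with hu
  have hTu : T *ᵥ u = ((c - t * d i : ℝ) : ℂ) • u := by
    funext l
    by_cases hl : d l = d i
    · have e : (T *ᵥ u) l = (T *ᵥ w) l := by
        simp only [mulVec, dotProduct]
        refine Finset.sum_congr rfl fun j _ => ?_
        by_cases hj : d j = d i
        · simp [hu, hj]
        · rw [hT l j (by rw [hl]; exact Ne.symm hj)]; simp
      have h1 := hw l
      rw [e, Pi.smul_apply, smul_eq_mul, show u l = w l by simp [hu, hl]]
      rw [hl] at h1
      push_cast
      linear_combination h1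
    · rw [Pi.smul_apply, show u l = 0 by simp [hu, hl], smul_zero]
      simp only [mulVec, dotProduct]
      refine Finset.sum_eq_zero fun j _ => ?_
      by_cases hj : d j = d i
      · rw [hT l j (by rw [hj]; exact hl), zero_mul]
      · simp [hu, hj]
  rw [← Matrix.spectrum_toLin']
  refine Module.End.HasEigenvalue.mem_spectrum (Module.End.hasEigenvalue_of_hasEigenvector
    (x := u) ⟨Module.End.mem_eigenspace_iff.2 (by rw [toLin'_apply, hTu]), fun h0 => hi ?_⟩)
  have := congrFun h0 i
  simpa [hu] using this

/-- For generic `t`, an eigenbasis of `A + t B` is a joint eigenbasis of the commuting Hermitian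
matrices `A` and `B`. -/
theorem exists_simultaneous_diagonalization {R T : Matrix n n ℂ} (hR : Rᴴ = R) (hT : Tᴴ = T)
    (hRT : R * T = T * R) :
    ∃ W ∈ unitaryGroup n ℂ, ∃ d e : n → ℝ, R = W * diagonal (fun i => (d i : ℂ)) * Wᴴ ∧
      T = W * diagonal (fun i => (e i : ℂ)) * Wᴴ := by
  obtain ⟨V, hV, d, rfl⟩ := exists_eq_unitary_mul_diagonal hR
  have hVV : Vᴴ * V = 1 := mem_unitaryGroup_iff'.1 hV
  have hVV' : V * Vᴴ = 1 := mem_unitaryGroup_iff.1 hV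
  set D : Matrix n n ℂ := diagonal fun i => (d i : ℂ) with hD
  have hDh : Dᴴ = D := by
    rw [hD, diagonal_conjTranspose]; congr 1; funext i; simp
  set T' := Vᴴ * T * V with hT'
  have hT'h : T'ᴴ = T' := by simp [hT', hT, mul_assoc]
  have hTT' : T = V * T' * Vᴴ := by
    rw [hT', show V * (Vᴴ * T * V) * Vᴴ = (V * Vᴴ) * T * (V * Vᴴ) by simp only [mul_assoc], hVV',
      one_mul, mul_one]
  have hcomm : D * T' = T' * D := by
    calc D * T' = Vᴴ * V * D * Vᴴ * T * V := by rw [hVV, one_mul, hT']; simp only [mul_assoc]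
      _ = Vᴴ * (V * D * Vᴴ * T) * V := by simp only [mul_assoc]
      _ = Vᴴ * T * V * D * (Vᴴ * V) := by rw [hRT]; simp only [mul_assoc]
      _ = T' * D := by rw [hVV, mul_one, hT']
  have hzero : ∀ i j, d i ≠ d j → T' i j = 0 := by
    intro i j hij
    have h1 := congrFun (congrFun hcomm i) j
    rw [hD, diagonal_mul, mul_diagonal] at h1
    have h2 : ((d i : ℂ) - d j) * T' i j = 0 := by linear_combination h1
    rcases mul_eq_zero.1 h2 with h | h
    · exact absurd (by exact_mod_cast sub_eq_zero.1 h) hij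
    · exact h
  -- avoid the finitely many `t` at which eigenvalues of `T' + t D` may collide
  have hfin : (⋃ i, ⋃ j, (fun x : ℂ × ℂ => (x.1 - x.2) / ((d j : ℂ) - d i)) ''
      (spectrum ℂ T' ×ˢ spectrum ℂ T')).Finite :=
    Set.finite_iUnion fun i => Set.finite_iUnion fun j =>
      ((T'.finite_spectrum.prod T'.finite_spectrum).image _)
  have hfin' := hfin.preimage (f := fun t : ℝ => (t : ℂ)) Complex.ofReal_injective.injOn
  obtain ⟨t, ht⟩ := hfin'.exists_notMem
  have hC : (T' + (t : ℂ) • D)ᴴ = T' + (t : ℂ) • D := by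
    rw [conjTranspose_add, conjTranspose_smul, hT'h, hDh]; simp
  obtain ⟨W, hW, c, hCW⟩ := exists_eq_unitary_mul_diagonal hC
  have hWW : Wᴴ * W = 1 := mem_unitaryGroup_iff'.1 hW
  have hWW' : W * Wᴴ = 1 := mem_unitaryGroup_iff.1 hW
  have hCW' : (T' + (t : ℂ) • D) * W = W * diagonal fun i => (c i : ℂ) := by
    rw [hCW, mul_assoc _ Wᴴ, hWW, mul_one]
  have heig : ∀ k i, (T' *ᵥ fun l => W l k) i + t * d i * W i k = c k * W i k := by
    intro k i
    have h1 := congrFun (congrFun hCW' i) k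
    rw [mul_diagonal, add_mul, smul_mul_assoc, Matrix.add_apply, Matrix.smul_apply, hD,
      diagonal_mul, smul_eq_mul] at h1
    have h2 : (T' *ᵥ fun l => W l k) i = (T' * W) i k := rfl
    rw [h2]
    linear_combination h1
  have hconst : ∀ k i j, W i k ≠ 0 → W j k ≠ 0 → d i = d j := by
    intro k i j hi hj
    by_contra hij
    refine ht ?_
    simp only [Set.mem_preimage, Set.mem_iUnion]
    refine ⟨i, j, (((c k - t * d i : ℝ) : ℂ), ((c k - t * d j : ℝ) : ℂ)),
      ⟨mem_spectrum_of_mulVec hzero (heig k) hi,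
      mem_spectrum_of_mulVec hzero (heig k) hj⟩, ?_⟩
    have hne : (d j : ℂ) - d i ≠ 0 := by
      rw [sub_ne_zero]; exact_mod_cast Ne.symm hij
    rw [div_eq_iff hne, Complex.ofReal_sub, Complex.ofReal_sub, Complex.ofReal_mul,
      Complex.ofReal_mul]
    ring
  have hd' : ∀ k, ∃ x : ℝ, ∀ i, (d i : ℂ) * W i k = x * W i k := by
    intro k
    by_cases hk : ∃ i, W i k ≠ 0
    · obtain ⟨i, hi⟩ := hk
      refine ⟨d i, fun j => ?_⟩
      by_cases hj : W j k = 0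
      · simp [hj]
      · rw [hconst k i j hi hj]
    · push Not at hk
      exact ⟨0, fun i => by simp [hk i]⟩
  choose d' hd' using hd'
  have hDW : D = W * diagonal (fun i => (d' i : ℂ)) * Wᴴ := by
    have : D * W = W * diagonal fun i => (d' i : ℂ) := by
      ext i k
      rw [hD, diagonal_mul, mul_diagonal, hd' k i, mul_comm]
    rw [← this, mul_assoc, hWW', mul_one]
  have hTW : T' = W * diagonal (fun i => ((c i - t * d' i : ℝ) : ℂ)) * Wᴴ := by
    have e : (diagonal fun i => ((c i - t * d' i : ℝ) : ℂ)) =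
        diagonal (fun i => (c i : ℂ)) - (t : ℂ) • diagonal fun i => (d' i : ℂ) := by
      ext i j
      by_cases hij : i = j
      · subst hij; simp
      · simp [hij]
    rw [e, mul_sub, sub_mul, mul_smul_comm, smul_mul_assoc, ← hDW, ← hCW]
    abel
  refine ⟨V * W, mul_mem hV hW, d', fun i => c i - t * d' i, ?_, ?_⟩
  · conv_lhs => rw [hDW]
    simp only [conjTranspose_mul, mul_assoc]
  · rw [hTT']
    conv_lhs => rw [hTW]
    simp only [conjTranspose_mul, mul_assoc]

end Diagonalization

/-! ### Absence of traps on the unitary group -/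

section NoTraps

variable {P Θ U : Matrix n n ℂ}

theorem isLocalMax_comp_curve {E : Type*} [NormedAddCommGroup E] [NormedSpace ℝ E] {f : E → ℝ}
    {M : Set E} {x : E} {γ : ℝ → E} (h : IsLocalMaxOn f M x) (hγ : IsCurveThrough M x γ) :
    IsLocalMax (f ∘ γ) 0 := by
  have hc : Tendsto γ (𝓝 0) (𝓝 x) := by
    have := hγ.1.continuous.tendsto 0
    rwa [hγ.2.2] at this
  filter_upwards [hc.eventually (eventually_nhdsWithin_iff.1 h)] with t ht
  simpa [hγ.2.2] using ht (hγ.2.1 t)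

theorem isStationary_of_isLocalMaxOn (hP : Pᴴ = P) (hΘ : Θᴴ = Θ) (hU : U ∈ unitaries n)
    (h : IsLocalMaxOn (traceForm P Θ) (unitaries n) U) : IsStationary P Θ U :=
  (isCriticalOn_unitaries_iff hP hΘ hU).1
    ⟨hU, fun _ hγ => (isLocalMax_comp_curve h hγ).deriv_eq_zero⟩

theorem deriv_deriv_nonpos_of_isLocalMax {g : ℝ → ℝ} (h : IsLocalMax g 0)
    (hc : ContinuousAt g 0) : deriv (deriv g) 0 ≤ 0 := by
  by_contra! hpos
  have hmin := isLocalMin_of_deriv_deriv_pos hpos h.deriv_eq_zero hc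
  -- a function with both a local maximum and a local minimum at `0` is constant near `0`
  have hconst : g =ᶠ[𝓝 0] fun _ => g 0 := by
    filter_upwards [h, hmin] with t h1 h2 using le_antisymm h1 h2
  have h0 : deriv g =ᶠ[𝓝 0] fun _ => (0 : ℝ) := by simpa using hconst.deriv
  rw [h0.deriv_eq] at hpos
  simp at hpos

theorem hessianForm_nonpos_of_isLocalMaxOn (hP : Pᴴ = P) (hΘ : Θᴴ = Θ) (hU : U ∈ unitaries n)
    (h : IsLocalMaxOn (traceForm P Θ) (unitaries n) U) {S : Matrix n n ℂ} (hS : Sᴴ = -S) :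
    hessianForm P Θ U (S * U) ≤ 0 := by
  obtain ⟨h1, h2⟩ := isCurveThrough_cayley hS hU
  have h3 := h1.isUnitaryGerm.iteratedDeriv_traceForm hP hΘ
    (isStationary_of_isLocalMaxOn hP hΘ hU h)
  rw [iteratedDeriv_succ, iteratedDeriv_one, 
    show deriv (fun t : ℝ => cayley ((t / 2) • S) * U) 0 = S * U from h2.deriv] at h3
  rw [← h3]
  exact deriv_deriv_nonpos_of_isLocalMax (isLocalMax_comp_curve h h1)
    ((continuous_traceForm P Θ).comp h1.1.continuous).continuousAt

/-- At a stationary point the rotated state commutes with the observable. -/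
theorem IsStationary.commute (hP : Pᴴ = P) (hΘ : Θᴴ = Θ) (h : IsStationary P Θ U) :
    U * P * Uᴴ * Θ = Θ * (U * P * Uᴴ) := by
  set R := U * P * Uᴴ with hR
  have hRh : Rᴴ = R := by simp [hR, hP, mul_assoc]
  set S := R * Θ - Θ * R with hS
  have hskew : Sᴴ = -S := by simp [hS, hRh, hΘ]
  have h1 : reTrace n (S * (R * Θ)) = 0 := by
    have := h S hskew
    rwa [show S * U * P * Uᴴ * Θ = S * (R * Θ) by simp only [hR, mul_assoc]] at this
  have h2 : reTrace n (S * (Θ * R)) = 0 := by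
    rw [← reTrace_conjTranspose] at h1
    simp only [conjTranspose_mul, hskew, hRh, hΘ] at h1
    rw [mul_neg, map_neg, neg_eq_zero, reTrace_mul_comm] at h1
    exact h1
  have h3 : reTrace n (Sᴴ * S) = 0 := by
    rw [hskew, neg_mul, map_neg]
    nth_rw 2 [hS]
    rw [mul_sub, map_sub, h1, h2]; simp
  have h4 : (Sᴴ * S).trace = 0 := by
    refine Complex.ext h3 ?_
    exact (Complex.nonneg_iff.1 (posSemidef_conjTranspose_mul_self S).trace_nonneg).2.symm
  rw [trace_conjTranspose_mul_self_eq_zero_iff] at h4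
  exact sub_eq_zero.1 h4

theorem traceForm_diagonal (d e : n → ℝ) (X : Matrix n n ℂ) :
    traceForm (diagonal fun i => (d i : ℂ)) (diagonal fun i => (e i : ℂ)) X =
      ∑ i, ∑ j, ‖X i j‖ ^ 2 * (d j * e i) := by
  simp only [traceForm, reTrace_apply, trace, diag_apply, mul_diagonal, Complex.re_sum]
  refine Finset.sum_congr rfl fun i _ => ?_
  rw [Matrix.mul_apply, Finset.sum_mul, Complex.re_sum]
  refine Finset.sum_congr rfl fun j _ => ?_
  rw [mul_diagonal, conjTranspose_apply, ← Complex.normSq_eq_norm_sq]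
  have : X i j * (d j : ℂ) * star (X i j) * (e i : ℂ) =
      ((Complex.normSq (X i j) * (d j * e i) : ℝ) : ℂ) := by
    push_cast
    rw [← Complex.mul_conj]
    simp only [RCLike.star_def]
    ring
  rw [this, Complex.ofReal_re]

/-- For real diagonal `P` and `Θ`, a local maximum at `1` forces the diagonals to be similarly
ordered: otherwise a rotation in a coordinate plane increases the value. -/
theorem monovary_of_isLocalMaxOn_one {d e : n → ℝ}
    (h : IsLocalMaxOn (traceForm (diagonal fun i => (d i : ℂ)) (diagonal fun i => (e i : ℂ)))
      (unitaries n) 1) : Monovary d e := by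
  have hdiag : ∀ f : n → ℝ, (diagonal fun i => (f i : ℂ))ᴴ = diagonal fun i => (f i : ℂ) := by
    intro f
    rw [diagonal_conjTranspose]; congr 1; funext i; simp
  intro i j hij
  have hne : i ≠ j := by rintro rfl; exact lt_irrefl _ hij
  set S : Matrix n n ℂ := single i j 1 - single j i 1 with hS
  have hskew : Sᴴ = -S := by simp [hS]
  have h1 := hessianForm_nonpos_of_isLocalMaxOn (hdiag d) (hdiag e)
    (show (1 : Matrix n n ℂ) ∈ unitaryGroup n ℂ from one_mem _) h hskew
  have hent : ∀ a b, ‖S a b‖ ^ 2 =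
      (if i = a ∧ j = b then 1 else 0) + (if j = a ∧ i = b then (1 : ℝ) else 0) := by
    intro a b
    rw [hS, Matrix.sub_apply, single_apply, single_apply]
    by_cases h1 : i = a ∧ j = b
    · have : ¬ (j = a ∧ i = b) := fun h2 => hne (h1.1.trans h2.1.symm)
      rw [if_pos h1, if_neg this, if_pos h1, if_neg this]; simp
    · rw [if_neg h1, if_neg h1]
      split_ifs <;> simp
  have hsum : ∀ c : n → n → ℝ, ∑ a, ∑ b, ‖S a b‖ ^ 2 * c a b = c i j + c j i := by
    intro c
    simp only [hent, add_mul, Finset.sum_add_distrib, ite_and, ite_mul, one_mul, zero_mul]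
    simp
  have h2 : hessianForm (diagonal fun i => (d i : ℂ)) (diagonal fun i => (e i : ℂ)) 1 (S * 1) =
      2 * traceForm (diagonal fun i => (d i : ℂ)) (diagonal fun i => (e i : ℂ)) S -
        2 * traceForm (diagonal fun _ => ((1 : ℝ) : ℂ))
          (diagonal fun i => ((d i * e i : ℝ) : ℂ)) S := by
    simp only [hessianForm, LinearMap.BilinMap.toQuadraticMap_apply, hessianBilin,
      LinearMap.mk₂_apply, traceForm, mul_one, conjTranspose_one]
    congr 3
    rw [mul_assoc, mul_assoc _ _ (diagonal _), diagonal_mul_diagonal]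
    simp [mul_assoc]
  rw [h2, traceForm_diagonal, traceForm_diagonal, hsum fun a b => d b * e a,
    hsum fun a b => 1 * (d a * e a)] at h1
  nlinarith

/-- The rearrangement inequality for the doubly stochastic matrix `‖X i j‖ ^ 2`, by Birkhoff's
theorem. -/
theorem sum_norm_sq_mul_le {d e : n → ℝ} (h : Monovary d e) {X : Matrix n n ℂ}
    (hX : X ∈ unitaryGroup n ℂ) :
    ∑ i, ∑ j, ‖X i j‖ ^ 2 * (d j * e i) ≤ ∑ i, d i * e i := by
  have hrow : ∀ i, ∑ j, ‖X i j‖ ^ 2 = 1 := by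
    intro i
    have h1 := congrFun (congrFun (mem_unitaryGroup_iff.1 hX) i) i
    rw [Matrix.mul_apply, one_apply_eq] at h1
    have h2 : ((∑ j, ‖X i j‖ ^ 2 : ℝ) : ℂ) = 1 := by
      rw [← h1]
      push_cast
      refine Finset.sum_congr rfl fun j _ => ?_
      rw [star_apply, RCLike.star_def, Complex.mul_conj, Complex.normSq_eq_norm_sq]
      push_cast; rfl
    exact_mod_cast h2
  have hcol : ∀ j, ∑ i, ‖X i j‖ ^ 2 = 1 := by
    intro j
    have h1 := congrFun (congrFun (mem_unitaryGroup_iff'.1 hX) j) j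
    rw [Matrix.mul_apply, one_apply_eq] at h1
    have h2 : ((∑ i, ‖X i j‖ ^ 2 : ℝ) : ℂ) = 1 := by
      rw [← h1]
      push_cast
      refine Finset.sum_congr rfl fun i _ => ?_
      rw [star_apply, RCLike.star_def, mul_comm, Complex.mul_conj, Complex.normSq_eq_norm_sq]
      push_cast; rfl
    exact_mod_cast h2
  -- the squared moduli form a convex combination of permutation matrices
  have hds : (Matrix.of fun i j => ‖X i j‖ ^ 2) ∈ doublyStochastic ℝ n :=
    mem_doublyStochastic_iff_sum.2 ⟨fun _ _ => by simp only [of_apply]; positivity, hrow, hcol⟩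
  obtain ⟨w, hw0, hw1, hw⟩ := exists_eq_sum_perm_of_mem_doublyStochastic hds
  have hent : ∀ i j, ‖X i j‖ ^ 2 = ∑ σ : Equiv.Perm n, w σ * (if σ i = j then 1 else 0) := by
    intro i j
    have := congrFun (congrFun hw i) j
    rw [of_apply] at this
    rw [← this, Matrix.sum_apply]
    refine Finset.sum_congr rfl fun σ _ => ?_
    rw [Matrix.smul_apply, smul_eq_mul, Equiv.Perm.permMatrix, PEquiv.toMatrix_apply]
    congr 2
    simp [eq_comm]
  calc ∑ i, ∑ j, ‖X i j‖ ^ 2 * (d j * e i)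
      = ∑ σ : Equiv.Perm n, w σ * ∑ i, d (σ i) * e i := by
        simp only [hent, Finset.sum_mul, Finset.mul_sum]
        rw [Finset.sum_congr rfl fun i _ => Finset.sum_comm, Finset.sum_comm]
        refine Finset.sum_congr rfl fun σ _ => Finset.sum_congr rfl fun i _ => ?_
        simp
    _ ≤ ∑ σ : Equiv.Perm n, w σ * ∑ i, d i * e i :=
        Finset.sum_le_sum fun σ _ =>
          mul_le_mul_of_nonneg_left (h.sum_comp_perm_smul_le_sum_smul (σ := σ)) (hw0 σ)
    _ = ∑ i, d i * e i := by rw [← Finset.sum_mul, hw1, one_mul]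

/-- Every local maximum of `Re Tr (U P U† Θ)` on the unitary group is a global maximum. -/
theorem isMaxOn_of_isLocalMaxOn (hP : Pᴴ = P) (hΘ : Θᴴ = Θ) (hU : U ∈ unitaries n)
    (h : IsLocalMaxOn (traceForm P Θ) (unitaries n) U) :
    IsMaxOn (traceForm P Θ) (unitaries n) U := by
  have hcomm := (isStationary_of_isLocalMaxOn hP hΘ hU h).commute hP hΘ
  have hR : (U * P * Uᴴ)ᴴ = U * P * Uᴴ := by simp [hP, mul_assoc]
  obtain ⟨W, hW, d, e, hd, he⟩ := exists_simultaneous_diagonalization hR hΘ hcomm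
  have hU' : U ∈ unitaryGroup n ℂ := hU
  have hUU : Uᴴ * U = 1 := mem_unitaryGroup_iff'.1 hU'
  have hWW : Wᴴ * W = 1 := mem_unitaryGroup_iff'.1 hW
  have hWW' : W * Wᴴ = 1 := mem_unitaryGroup_iff.1 hW
  -- the change of variables `X ↦ W X W† U` diagonalizes the problem and sends `1` to `U`
  have hval : ∀ X, traceForm P Θ (W * X * Wᴴ * U) =
      traceForm (diagonal fun i => (d i : ℂ)) (diagonal fun i => (e i : ℂ)) X := by
    intro X
    generalize (diagonal fun i => (d i : ℂ)) = D at hd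
    generalize (diagonal fun i => (e i : ℂ)) = T at he
    calc traceForm P Θ (W * X * Wᴴ * U)
        = reTrace n (W * X * Wᴴ * (U * P * Uᴴ) * W * Xᴴ * Wᴴ * Θ) := by
          simp only [traceForm, conjTranspose_mul, conjTranspose_conjTranspose, mul_assoc]
      _ = reTrace n (W * (X * (Wᴴ * W) * D * (Wᴴ * W) * Xᴴ * (Wᴴ * W) * T * Wᴴ)) := by
          rw [hd, he]; simp only [mul_assoc]
      _ = traceForm D T X := by
          rw [reTrace_mul_comm, hWW]
          simp only [mul_one, mul_assoc, hWW, traceForm]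
  have hone : W * 1 * Wᴴ * U = U := by rw [mul_one, hWW', one_mul]
  have hmem : ∀ X ∈ unitaryGroup n ℂ, W * X * Wᴴ * U ∈ unitaryGroup n ℂ := fun X hX =>
    mul_mem (mul_mem (mul_mem hW hX) (Unitary.star_mem hW)) hU'
  have hloc : IsLocalMaxOn
      (traceForm (diagonal fun i => (d i : ℂ)) (diagonal fun i => (e i : ℂ))) (unitaries n) 1 := by
    have hc : Tendsto (fun X : Matrix n n ℂ => W * X * Wᴴ * U) (𝓝 1) (𝓝 U) := by
      have hcont : Continuous fun X : Matrix n n ℂ => W * X * Wᴴ * U :=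
        ((continuous_const.matrix_mul continuous_id).matrix_mul continuous_const).matrix_mul
          continuous_const
      have := hcont.tendsto 1
      simp only [hone] at this
      exact this
    refine eventually_nhdsWithin_iff.2 ?_
    filter_upwards [hc.eventually (eventually_nhdsWithin_iff.1 h)] with X hX hXU
    rw [← hval, ← hval, hone]
    exact hX (hmem X hXU)
  intro V hV
  have hV' : V ∈ unitaryGroup n ℂ := hV
  have hX : Wᴴ * V * Uᴴ * W ∈ unitaryGroup n ℂ :=
    mul_mem (mul_mem (mul_mem (Unitary.star_mem hW) hV') (Unitary.star_mem hU')) hW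
  have hVX : W * (Wᴴ * V * Uᴴ * W) * Wᴴ * U = V := by
    rw [show W * (Wᴴ * V * Uᴴ * W) * Wᴴ * U = (W * Wᴴ) * V * Uᴴ * (W * Wᴴ) * U by
      simp only [mul_assoc], hWW', one_mul, mul_one, mul_assoc, hUU, mul_one]
  change traceForm P Θ V ≤ traceForm P Θ U
  rw [show traceForm P Θ U = _ by rw [← hone, hval], ← hVX, hval, traceForm_diagonal,
    traceForm_diagonal]
  refine (sum_norm_sq_mul_le (monovary_of_isLocalMaxOn_one hloc) hX).trans_eq ?_
  refine Finset.sum_congr rfl fun i _ => ?_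
  rw [Finset.sum_eq_single i (fun j _ hj => by simp [one_apply_ne hj.symm]) (by simp)]
  simp

end NoTraps

end General

/-! ### The open-system landscape and its lift as trace forms -/

section Kraus

/-- Inverting the nonzero eigenvalues yields a generalized inverse (here `0⁻¹ = 0` is harmless). -/
theorem exists_isHermitianPseudoInverse {n : Type*} [Fintype n] [DecidableEq n]
    {A : Matrix n n ℂ} (hA : Aᴴ = A) : ∃ B, IsHermitianPseudoInverse A B := by
  obtain ⟨V, hV, d, rfl⟩ := exists_eq_unitary_mul_diagonal hA
  have hVV : Vᴴ * V = 1 := mem_unitaryGroup_iff'.1 hV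
  have hmul : ∀ X Y : Matrix n n ℂ, V * X * Vᴴ * (V * Y * Vᴴ) = V * (X * Y) * Vᴴ := by
    intro X Y
    rw [show V * X * Vᴴ * (V * Y * Vᴴ) = V * X * (Vᴴ * V) * Y * Vᴴ by simp only [mul_assoc], hVV,
      mul_one, mul_assoc V]
  refine ⟨V * diagonal (fun i => ((d i)⁻¹ : ℂ)) * Vᴴ, hA, ?_, ?_, ?_⟩
  · rw [conjTranspose_mul, conjTranspose_mul, conjTranspose_conjTranspose, diagonal_conjTranspose,
      mul_assoc]
    congr 3
    funext i
    simp
  · rw [hmul, hmul, diagonal_mul_diagonal, diagonal_mul_diagonal]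
    simp only [mul_comm]
  · rw [hmul, hmul, diagonal_mul_diagonal, diagonal_mul_diagonal]
    congr 3
    funext i
    exact mul_inv_mul_cancel (d i : ℂ)

theorem trace_eq_ofReal {n : Type*} [Fintype n] [DecidableEq n] {R Θ : Matrix n n ℂ}
    (hR : Rᴴ = R) (hΘ : Θᴴ = Θ) (X : Matrix n n ℂ) :
    (X * R * Xᴴ * Θ).trace = ((X * R * Xᴴ * Θ).trace.re : ℂ) := by
  refine (Complex.conj_eq_iff_re.1 ?_).symm
  rw [← RCLike.star_def, ← trace_conjTranspose]
  simp only [conjTranspose_mul, conjTranspose_conjTranspose, hR, hΘ]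
  rw [trace_mul_comm]
  simp only [mul_assoc]

variable {N lam : ℕ} {ρ θ : Matrix (Fin N) (Fin N) ℂ} {ϱ : Matrix (Fin lam) (Fin lam) ℂ}

/-- The blocks of `K (ρ ⊗ I) K†` in terms of the Kraus operators. -/
theorem mul_kronecker_one_mul_conjTranspose_apply (ρ : Matrix (Fin N) (Fin N) ℂ)
    (K : Matrix (Fin N × Fin lam) (Fin N × Fin lam) ℂ) (i l : Fin N) (α γ : Fin lam) :
    (K * (ρ ⊗ₖ (1 : Matrix (Fin lam) (Fin lam) ℂ)) * Kᴴ) (i, α) (l, γ) =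
      ∑ β, (krausOp K α β * ρ * (krausOp K γ β)ᴴ) i l := by
  simp only [Matrix.mul_apply, Fintype.sum_prod_type, kroneckerMap_apply, one_apply, krausOp,
    conjTranspose_apply, of_apply, mul_ite, mul_one, mul_zero, Finset.sum_ite_eq',
    Finset.mem_univ, if_true]
  rw [Finset.sum_comm]

theorem krausTrace_eq (ρ θ : Matrix (Fin N) (Fin N) ℂ)
    (K : Matrix (Fin N × Fin lam) (Fin N × Fin lam) ℂ) :
    krausTrace ρ θ K = Matrix.trace (K * (ρ ⊗ₖ (1 : Matrix (Fin lam) (Fin lam) ℂ)) * Kᴴ *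
        (θ ⊗ₖ (1 : Matrix (Fin lam) (Fin lam) ℂ))) := by
  have h : ∀ (i : Fin N) (α : Fin lam),
      (K * (ρ ⊗ₖ (1 : Matrix (Fin lam) (Fin lam) ℂ)) * Kᴴ *
        (θ ⊗ₖ (1 : Matrix (Fin lam) (Fin lam) ℂ))) (i, α) (i, α) =
      ((∑ β, krausOp K α β * ρ * (krausOp K α β)ᴴ) * θ) i i := by
    intro i α
    rw [Matrix.mul_apply, Matrix.mul_apply, Fintype.sum_prod_type]
    refine Finset.sum_congr rfl fun l _ => ?_
    simp only [mul_kronecker_one_mul_conjTranspose_apply, kroneckerMap_apply, one_apply, mul_ite,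
      mul_one, mul_zero, Finset.sum_ite_eq', Finset.mem_univ, if_true, Matrix.sum_apply]
  rw [krausTrace, trace, trace, Fintype.sum_prod_type]
  refine Finset.sum_congr rfl fun i _ => ?_
  simp only [diag_apply, h]
  rw [Finset.sum_mul, Matrix.sum_apply]

theorem openLandscape_eq (ρ θ : Matrix (Fin N) (Fin N) ℂ) :
    openLandscape (lam := lam) ρ θ =
      traceForm (ρ ⊗ₖ (1 : Matrix (Fin lam) (Fin lam) ℂ))
        (θ ⊗ₖ (1 : Matrix (Fin lam) (Fin lam) ℂ)) := by
  funext K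
  rw [openLandscape, krausTrace_eq]
  rfl

theorem kronecker_conjTranspose {σ : Matrix (Fin N) (Fin N) ℂ} {τ : Matrix (Fin lam) (Fin lam) ℂ}
    (hσ : σᴴ = σ) (hτ : τᴴ = τ) : (σ ⊗ₖ τ)ᴴ = σ ⊗ₖ τ := by
  rw [conjTranspose_kronecker, hσ, hτ]

theorem sqrt_conjTranspose (ϱ : Matrix (Fin lam) (Fin lam) ℂ) :
    (CFC.sqrt ϱ)ᴴ = CFC.sqrt ϱ :=
  (IsSelfAdjoint.of_nonneg (CFC.sqrt_nonneg ϱ)).star_eq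

theorem sqrt_kronecker_mul (ρ : Matrix (Fin N) (Fin N) ℂ) (hϱ : ϱ.PosSemidef) :
    ((1 : Matrix (Fin N) (Fin N) ℂ) ⊗ₖ CFC.sqrt ϱ) * (ρ ⊗ₖ (1 : Matrix (Fin lam) (Fin lam) ℂ)) *
      ((1 : Matrix (Fin N) (Fin N) ℂ) ⊗ₖ CFC.sqrt ϱ) = ρ ⊗ₖ ϱ := by
  rw [← mul_kronecker_mul, ← mul_kronecker_mul, one_mul, mul_one, mul_one,
    CFC.sqrt_mul_sqrt_self ϱ hϱ.nonneg]

/-- A local maximum on the orbit lifts to a local, hence global, maximum on the unitary group. -/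
theorem isMaxOn_orbit_of_isLocalMaxOn {n : Type*} [Fintype n] [DecidableEq n]
    {A B P R Θ K : Matrix n n ℂ} (h : IsHermitianPseudoInverse A B) (hAR : A * R * A = P)
    (hP : Pᴴ = P) (hΘ : Θᴴ = Θ) (hK : K ∈ orbit A)
    (hm : IsLocalMaxOn (traceForm R Θ) (orbit A) K) : IsMaxOn (traceForm R Θ) (orbit A) K := by
  obtain ⟨U, hU, rfl⟩ := hK
  have hmax := isMaxOn_of_isLocalMaxOn hP hΘ hU ((isLocalMaxOn_orbit_iff h hAR hU).2 hm)
  rintro _ ⟨V, hV, rfl⟩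
  change traceForm R Θ (V * A) ≤ traceForm R Θ (U * A)
  rw [traceForm_mul h.left hAR, traceForm_mul h.left hAR]
  exact hmax hV

theorem isMinOn_orbit_of_isLocalMinOn {n : Type*} [Fintype n] [DecidableEq n]
    {A B P R Θ K : Matrix n n ℂ} (h : IsHermitianPseudoInverse A B) (hAR : A * R * A = P)
    (hP : Pᴴ = P) (hΘ : Θᴴ = Θ) (hK : K ∈ orbit A)
    (hm : IsLocalMinOn (traceForm R Θ) (orbit A) K) : IsMinOn (traceForm R Θ) (orbit A) K := by
  have hmax := isMaxOn_orbit_of_isLocalMaxOn h hAR hP (Θ := -Θ) (by rw [conjTranspose_neg, hΘ]) hK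
    (isLocalMaxOn_traceForm_neg.2 hm)
  intro X hX
  have := hmax hX
  simpa only [Set.mem_ofPred_eq, traceForm_neg, neg_le_neg_iff] using this

end Kraus

end OpenLandscape

theorem mainTheorem2 (N lam : ℕ) (ρ θ : Matrix (Fin N) (Fin N) ℂ)
    (ϱ : Matrix (Fin lam) (Fin lam) ℂ)
    (hρ : IsDensityMatrix ρ) (hϱ : IsDensityMatrix ϱ) (hθ : θ.IsHermitian) :
    -- the trace expressions are real, and the lifting identity
    (∀ K ∈ krausSet N ϱ,
      krausTrace ρ θ K = (openLandscape ρ θ K : ℂ) ∧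
      krausTrace ρ θ K = Matrix.trace (K * (ρ ⊗ₖ (1 : Matrix (Fin lam) (Fin lam) ℂ)) * Kᴴ *
        (θ ⊗ₖ (1 : Matrix (Fin lam) (Fin lam) ℂ)))) ∧
    (∀ U ∈ unitarySet N lam,
      liftedTrace ρ θ ϱ U = (liftedLandscape ρ θ ϱ U : ℂ) ∧
      krausTrace ρ θ (krausMap N ϱ U) = liftedTrace ρ θ ϱ U) ∧
    -- critical points, local maxima and local minima correspond
    (∀ U ∈ unitarySet N lam,
      (IsCriticalOn (liftedLandscape ρ θ ϱ) (unitarySet N lam) U ↔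
        IsCriticalOn (openLandscape ρ θ) (krausSet N ϱ) (krausMap N ϱ U)) ∧
      (IsLocalMaxOn (liftedLandscape ρ θ ϱ) (unitarySet N lam) U ↔
        IsLocalMaxOn (openLandscape ρ θ) (krausSet N ϱ) (krausMap N ϱ U)) ∧
      (IsLocalMinOn (liftedLandscape ρ θ ϱ) (unitarySet N lam) U ↔
        IsLocalMinOn (openLandscape ρ θ) (krausSet N ϱ) (krausMap N ϱ U))) ∧
    -- at critical points the Hessians exist and have the same numbers of positive and of
    -- negative eigenvalues
    (∀ U ∈ criticalSet (liftedLandscape ρ θ ϱ) (unitarySet N lam),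
      (∃! Q, IsHessianOn (liftedLandscape ρ θ ϱ) (unitarySet N lam) U Q) ∧
      (∃! Q, IsHessianOn (openLandscape ρ θ) (krausSet N ϱ) (krausMap N ϱ U) Q) ∧
      ∀ Q Q', IsHessianOn (liftedLandscape ρ θ ϱ) (unitarySet N lam) U Q →
        IsHessianOn (openLandscape ρ θ) (krausSet N ϱ) (krausMap N ϱ U) Q' →
        sigPos Q = sigPos Q' ∧
        sigNeg Q = sigNeg Q') ∧
    -- the connected components of the critical sets correspond one-to-one
    Set.BijOn (fun C => krausMap N ϱ '' C)
      (components (criticalSet (liftedLandscape ρ θ ϱ) (unitarySet N lam)))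
      (components (criticalSet (openLandscape ρ θ) (krausSet N ϱ))) ∧
    -- no false traps
    (∀ K ∈ krausSet N ϱ,
      (IsLocalMaxOn (openLandscape ρ θ) (krausSet N ϱ) K →
        IsMaxOn (openLandscape ρ θ) (krausSet N ϱ) K) ∧
      (IsLocalMinOn (openLandscape ρ θ) (krausSet N ϱ) K →
        IsMinOn (openLandscape ρ θ) (krausSet N ϱ) K)) := by
  have hρh : ρᴴ = ρ := hρ.1.isHermitian
  have hϱh : ϱᴴ = ϱ := hϱ.1.isHermitian
  have hR : (ρ ⊗ₖ (1 : Matrix (Fin lam) (Fin lam) ℂ))ᴴ = ρ ⊗ₖ 1 :=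
    kronecker_conjTranspose hρh conjTranspose_one
  have hΘ : (θ ⊗ₖ (1 : Matrix (Fin lam) (Fin lam) ℂ))ᴴ = θ ⊗ₖ 1 :=
    kronecker_conjTranspose hθ conjTranspose_one
  have hP : (ρ ⊗ₖ ϱ)ᴴ = ρ ⊗ₖ ϱ := kronecker_conjTranspose hρh hϱh
  have hA : ((1 : Matrix (Fin N) (Fin N) ℂ) ⊗ₖ CFC.sqrt ϱ)ᴴ = 1 ⊗ₖ CFC.sqrt ϱ :=
    kronecker_conjTranspose conjTranspose_one (sqrt_conjTranspose ϱ)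
  have hAR := sqrt_kronecker_mul ρ hϱ.1
  obtain ⟨B, hB⟩ := exists_isHermitianPseudoInverse hA
  have hlift : liftedLandscape ρ θ ϱ =
      traceForm (ρ ⊗ₖ ϱ) (θ ⊗ₖ (1 : Matrix (Fin lam) (Fin lam) ℂ)) := rfl
  have hset : unitarySet N lam = unitaries (Fin N × Fin lam) := rfl
  have hK : krausSet N ϱ = orbit ((1 : Matrix (Fin N) (Fin N) ℂ) ⊗ₖ CFC.sqrt ϱ) := rfl
  have hmap : krausMap N ϱ = fun U => U * ((1 : Matrix (Fin N) (Fin N) ℂ) ⊗ₖ CFC.sqrt ϱ) := rfl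
  refine ⟨fun K _ => ⟨?_, krausTrace_eq ρ θ K⟩, fun U _ => ⟨trace_eq_ofReal hP hΘ U, ?_⟩, ?_⟩
  · rw [openLandscape, krausTrace_eq]
    exact trace_eq_ofReal hR hΘ K
  · rw [krausTrace_eq, liftedTrace, krausMap, conjTranspose_mul, hA, ← hAR]
    simp only [mul_assoc]
  rw [openLandscape_eq, hlift, hset, hK, hmap]
  refine ⟨fun U hU => ⟨?_, isLocalMaxOn_orbit_iff hB hAR hU, isLocalMinOn_orbit_iff hB hAR hU⟩,
    fun U hU => ?_, bijOn_components_criticalSet hB hAR hP hΘ,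
    fun K hK => ⟨isMaxOn_orbit_of_isLocalMaxOn hB hAR hP hΘ hK,
      isMinOn_orbit_of_isLocalMinOn hB hAR hP hΘ hK⟩⟩
  · exact (isCriticalOn_unitaries_iff hP hΘ hU).trans
      (isCriticalOn_orbit_iff hB hAR hP hΘ hU).symm
  · have hs := (isCriticalOn_unitaries_iff hP hΘ hU.1).1 hU
    exact ⟨existsUnique_isHessianOn_unitaries hP hΘ hU.1 hs,
      existsUnique_isHessianOn_orbit hB hAR hP hΘ hU.1 hs,
      fun Q Q' hQ hQ' => signature_eq hB hAR hU.1 hQ hQ'⟩
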